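/- Let $0<\theta<1$, let $\mathbb{B}^2\subset\mathbb{R}^2$ be the open unit disc, and define $A:\mathbb{R}^2\to\mathbb{R}^2$ by $$A(\eta)=\big((1+\sqrt{\theta}\,\sin(\pi\eta_1))\,\eta_1,\ (1+\sqrt{\theta}\,\sin(\pi\eta_2))\,\eta_2\big),$$ and the threshold exponent $$\bar q=\sup_{L\in\{2,4,6,\dots\}}\left(1-\frac{1}{1+L}+\frac{1}{1+L(1-\theta)}\right).$$ A regular domain is an open, bounded, connected subset of $\mathbb{R}^2$ whose boundary has Lebesgue measure zero. A function $w\in W^{1,1}(\mathbb{B}^2)$ is called piecewise affine if there are at most countably many pairwise disjoint regular domains $\Omega_i\subset\mathbb{B}^2$ that cover $\mathbb{B}^2$ up to a Lebesgue null set, such that $w$ is affine on each $\Omega_i$. For a scalar function $v$ write $\nabla^\perp v=(-\partial_2 v,\partial_1 v)$. Theorem. For every $\Lambda>0$ and every $q\in(1,\bar q)$ there exist piecewise affine Lipschitz functions $u,v\in W^{1,2}_0(\mathbb{B}^2)\cap\mathrm{Lip}(\mathbb{B}^2)$ such that, for all $r\in(1,q)$, $$\int_{\mathbb{B}^2}|\nabla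 u|^r\,dx>\Lambda\left(1+\int_{\mathbb{B}^2}|A(\nabla u)-\nabla^\perp v|^r\,dx\right)$$ (both integrals being finite). -/

import Mathlib

open MeasureTheory Filter Topology
open scoped ENNReal ContDiff

noncomputable section

namespace CZ

/-- The Euclidean plane. -/
abbrev Plane : Type := EuclideanSpace ℝ (Fin 2)

/-- The open unit disc. -/
def disc : Set Plane := Metric.ball 0 1

/-- The nonlinearity
`A(η) = ((1 + √θ sin(π η₁)) η₁, (1 + √θ sin(π η₂)) η₂)`. -/
def A (θ : ℝ) (η : Plane) : Plane :=
  !₂[(1 + √θ * Real.sin (Real.pi * η 0)) * η 0, (1 + √θ * Real.sin (Real.pi * η 1)) * η 1]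

/-- The threshold exponent: the supremum, over the positive even integers `L`, of
`1 - 1 / (1 + L) + 1 / (1 + L (1 - θ))`. For `0 < θ < 1` this set is bounded above by `2`. -/
def qBar (θ : ℝ) : ℝ :=
  sSup {x : ℝ | ∃ L : ℕ, 0 < L ∧ Even L ∧
    x = 1 - 1 / (1 + (L : ℝ)) + 1 / (1 + (L : ℝ) * (1 - θ))}

/-- The rotated gradient `∇^⊥ v = (-∂₂ v, ∂₁ v)`. -/
def perpGradient (v : Plane → ℝ) (x : Plane) : Plane :=
  !₂[-(gradient v x 1), gradient v x 0]

/-- Smooth functions on the plane with compact support contained in `Ω`. -/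
def IsTestFunction (Ω : Set Plane) (φ : Plane → ℝ) : Prop :=
  ContDiff ℝ ∞ φ ∧ HasCompactSupport φ ∧ tsupport φ ⊆ Ω

/-- `g` is the weak (distributional) gradient of `u` on the open set `Ω`. -/
def HasWeakGradient (Ω : Set Plane) (u : Plane → ℝ) (g : Plane → Plane) : Prop :=
  LocallyIntegrableOn u Ω ∧ LocallyIntegrableOn g Ω ∧
    ∀ φ : Plane → ℝ, IsTestFunction Ω φ →
      ∫ x in Ω, u x • gradient φ x = -∫ x in Ω, φ x • g x

/-- The Sobolev space `W^{1,p}(Ω)`. -/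
def MemW1 (Ω : Set Plane) (p : ℝ≥0∞) (u : Plane → ℝ) : Prop :=
  MemLp u p (volume.restrict Ω) ∧
    ∃ g : Plane → Plane, MemLp g p (volume.restrict Ω) ∧ HasWeakGradient Ω u g

/-- The Sobolev space `W^{1,p}_0(Ω)`: the closure of the test functions on `Ω` in `W^{1,p}(Ω)`. -/
def MemW1Zero (Ω : Set Plane) (p : ℝ≥0∞) (u : Plane → ℝ) : Prop :=
  MemLp u p (volume.restrict Ω) ∧
    ∃ g : Plane → Plane, MemLp g p (volume.restrict Ω) ∧ HasWeakGradient Ω u g ∧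
      ∃ φ : ℕ → Plane → ℝ, (∀ n, IsTestFunction Ω (φ n)) ∧
        Tendsto (fun n => eLpNorm (fun x => φ n x - u x) p (volume.restrict Ω)) atTop (𝓝 0) ∧
        Tendsto (fun n => eLpNorm (fun x => gradient (φ n) x - g x) p (volume.restrict Ω))
          atTop (𝓝 0)

/-- Regular domains: open, bounded, connected sets whose boundary is a Lebesgue null set. -/
def IsRegularDomain (Ω : Set Plane) : Prop :=
  IsOpen Ω ∧ Bornology.IsBounded Ω ∧ IsConnected Ω ∧ volume (frontier Ω) = 0

/-- Piecewise affine functions on `Ω`: members of `W^{1,1}(Ω)` which are affine on each member of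
an at most countable family of pairwise disjoint regular domains that covers `Ω` up to a null
set. -/
def IsPiecewiseAffine (Ω : Set Plane) (u : Plane → ℝ) : Prop :=
  MemW1 Ω 1 u ∧
    ∃ D : Set (Set Plane), D.Countable ∧ D.PairwiseDisjoint id ∧
      (∀ U ∈ D, IsRegularDomain U ∧ U ⊆ Ω ∧
        ∃ (ξ : Plane) (b : ℝ), ∀ x ∈ U, u x = inner ℝ ξ x + b) ∧
      volume (Ω \ ⋃₀ D) = 0

end CZ

end

/-! The residual A(∇u) − ∇^⊥v has entries amp(∂₁u) + ∂₂v and amp(∂₂u) − ∂₁v. If ∂₂u and ∂₁v stay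
bounded, only the pair (x, y) = (∂₁u, −∂₂v) matters: the residual is bounded when (x, y) lies near
the graph of `amp`, which oscillates between the lines of slope 1 − √θ and 1 + √θ. Since u and v can
be laminated independently, a pair may be split horizontally (through u) or vertically (through v).

The staircase, for sign ε = 1, keeps an unfinished pair (X, −tX). A horizontal split gives (X + 2,
−tX) and (−W, −tX), where (1 + √θ)W ≈ tX; a vertical split of the former gives (X + 2, −t(X + 2))
and (X + 2, (1 − √θ)(X + 2)). Both by-products are on or near the graph. The unfinished mass is at
most a multiple of X^(−q') for any q' < `decayExponent θ t` (`mass_step_le`, `exists_staircase`),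
while the residual there is O(X); hence for q < q' its r-th power contributes little, uniformly in r
< q, once the staircase is long. The choice t = L(1 − √θ) makes the exponent at least the L-th term
of `qBar` (`exists_lt_decayExponent`).

Zero boundary values force ∂₁u to take both signs, so one staircase of each sign is run
(`exists_pair`). All steps start at height at least R, so |∇u| ≥ R a.e. on a fixed disc, while the
bound on the residual does not depend on R (`exists_steep_pair`); a large R gives the theorem. Each
split is realised exactly by `exists_laminate`, and `memW1Zero_two` and
`isPiecewiseAffine_of_ae_affine` place the resulting functions in the required classes. -/

noncomputable section

namespace CZ

/-! ### Locally affine functions and coordinates in the plane. -/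

/-- `u` is affine with gradient `ξ` in a neighbourhood of `z`. -/
def IsAffineNear (u : Plane → ℝ) (z ξ : Plane) : Prop :=
  ∃ c : ℝ, ∀ᶠ y in 𝓝 z, u y = inner ℝ ξ y + c

lemma inner_eq_of_ne {i j : Fin 2} (hij : i ≠ j) (ξ y : Plane) :
    inner ℝ ξ y = ξ i * y i + ξ j * y j := by
  simp only [PiLp.inner_apply, Fin.sum_univ_two, RCLike.inner_apply, conj_trivial]
  fin_cases i <;> fin_cases j <;> simp_all <;> ring

lemma norm_sq_eq_of_ne {i j : Fin 2} (hij : i ≠ j) (y : Plane) :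
    ‖y‖ ^ 2 = y i ^ 2 + y j ^ 2 := by
  rw [← real_inner_self_eq_norm_sq, inner_eq_of_ne hij]; ring

lemma norm_le_add_of_ne {i j : Fin 2} (hij : i ≠ j) (y : Plane) : ‖y‖ ≤ |y i| + |y j| := by
  refine abs_le_of_sq_le_sq' ?_ (by positivity) |>.2
  rw [norm_sq_eq_of_ne hij]
  nlinarith [sq_abs (y i), sq_abs (y j), mul_nonneg (abs_nonneg (y i)) (abs_nonneg (y j))]

lemma abs_apply_le_norm (i : Fin 2) (y : Plane) : |y i| ≤ ‖y‖ := by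
  simpa using PiLp.norm_apply_le y i

lemma abs_apply_sub_le_dist (i : Fin 2) (y z : Plane) : |y i - z i| ≤ dist y z := by
  simpa [dist_eq_norm] using abs_apply_le_norm i (y - z)

/-- The vector with coordinate `a` in direction `i` and `b` in direction `j`. -/
def vec (i j : Fin 2) (a b : ℝ) : Plane :=
  EuclideanSpace.single i a + EuclideanSpace.single j b

lemma vec_fst {i j : Fin 2} (hij : i ≠ j) (a b : ℝ) : vec i j a b i = a := by
  simp [vec, hij]

lemma vec_snd {i j : Fin 2} (hij : i ≠ j) (a b : ℝ) : vec i j a b j = b := by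
  simp [vec, hij.symm]

namespace IsAffineNear

variable {u v : Plane → ℝ} {z ξ ζ : Plane}

lemma hasGradientAt (h : IsAffineNear u z ξ) : HasGradientAt u ξ z := by
  obtain ⟨c, hc⟩ := h
  have : HasGradientAt (fun y : Plane => inner ℝ ξ y + c) ξ z := by
    rw [hasGradientAt_iff_hasFDerivAt]
    exact ((InnerProductSpace.toDual ℝ Plane ξ).hasFDerivAt).add_const c
  exact this.congr_of_eventuallyEq hc

lemma gradient_eq (h : IsAffineNear u z ξ) : gradient u z = ξ := h.hasGradientAt.gradient

lemma add (hu : IsAffineNear u z ξ) (hv : IsAffineNear v z ζ) :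
    IsAffineNear (fun y => u y + v y) z (ξ + ζ) := by
  obtain ⟨c, hc⟩ := hu
  obtain ⟨d, hd⟩ := hv
  refine ⟨c + d, ?_⟩
  filter_upwards [hc, hd] with y h1 h2
  rw [h1, h2, inner_add_left]; ring

lemma congr (hu : IsAffineNear u z ξ) (h : v =ᶠ[𝓝 z] u) : IsAffineNear v z ξ := by
  obtain ⟨c, hc⟩ := hu
  refine ⟨c, ?_⟩
  filter_upwards [hc, h] with y h1 h2
  rw [h2, h1]

lemma eventually (hu : IsAffineNear u z ξ) : ∀ᶠ y in 𝓝 z, IsAffineNear u y ξ := by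
  obtain ⟨c, hc⟩ := hu
  filter_upwards [hc.eventually_nhds] with y hy using ⟨c, hy⟩

end IsAffineNear

lemma isOpen_setOf_affineNear (u : Plane → ℝ) (p : Plane → Prop) :
    IsOpen {z | ∃ ξ, IsAffineNear u z ξ ∧ p ξ} := by
  rw [isOpen_iff_mem_nhds]
  rintro z ⟨ξ, h, hp⟩
  filter_upwards [h.eventually] with y hy using ⟨ξ, hy, hp⟩

lemma isAffineNear_zero_of_notMem_closure {u : Plane → ℝ} {s : Set Plane} {z : Plane}
    (hu : ∀ y ∉ s, u y = 0) (hz : z ∉ closure s) : IsAffineNear u z 0 := by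
  refine ⟨0, ?_⟩
  filter_upwards [isClosed_closure.isOpen_compl.mem_nhds hz] with y hy
  simp [hu y fun h => hy (subset_closure h)]

lemma volume_line_eq_zero {i j : Fin 2} (hij : i ≠ j) {p q : ℝ} (h : p ≠ 0 ∨ q ≠ 0) (c : ℝ) :
    volume {z : Plane | p * z i + q * z j = c} = 0 := by
  let S : AffineSubspace ℝ Plane :=
    { carrier := {z : Plane | p * z i + q * z j = c}
      smul_vsub_vadd_mem' := by
        intro t a b d ha hb hd
        simp only [Set.mem_ofPred_eq, vsub_eq_sub, vadd_eq_add, PiLp.add_apply, PiLp.smul_apply,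
          PiLp.sub_apply, smul_eq_mul] at *
        linear_combination t * ha - t * hb + hd }
  refine Measure.addHaar_affineSubspace volume S fun hS => ?_
  have key : ∀ z : Plane, p * z i + q * z j = c := fun z => by
    have : z ∈ S := by rw [hS]; trivial
    exact this
  -- Were the line the whole plane, the origin and the point (p, q) would both lie on it, forcing p²
  -- + q² = 0.
  have h0 := key 0
  have h1 := key (vec i j p q)
  rw [vec_fst hij, vec_snd hij] at h1
  simp only [PiLp.zero_apply, mul_zero, add_zero] at h0
  have : p * p + q * q = 0 := by linarith
  rcases h with h | h
  · nlinarith [mul_self_pos.2 h, mul_self_nonneg q]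
  · nlinarith [mul_self_pos.2 h, mul_self_nonneg p]

/-! ### Tents over kites and exact one-directional lamination. -/

/-- The concave piecewise affine profile whose positive part is `roof`. -/
def roofProfile (i j : Fin 2) (α β δ : ℝ) (a : Plane × ℝ) (z : Plane) : ℝ :=
  min (a.2 + α * (z i - a.1 i)) (a.2 - β * (z i - a.1 i)) - δ * |z j - a.1 j|

/-- The tent of height `a.2` over the kite centred at `a.1`: its slopes in direction `i` are `α`
and `-β`, its slopes in direction `j` are `± δ`. -/
def roof (i j : Fin 2) (α β δ : ℝ) (a : Plane × ℝ) (z : Plane) : ℝ :=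
  max 0 (roofProfile i j α β δ a z)

/-- The kite over which the tent `roof` is raised. -/
def kite (i j : Fin 2) (α β δ : ℝ) (a : Plane × ℝ) : Set Plane :=
  {z | 0 ≤ roofProfile i j α β δ a z}

section

variable {i j : Fin 2} {α β δ : ℝ}

lemma continuous_roofProfile (a : Plane × ℝ) : Continuous (roofProfile i j α β δ a) := by
  unfold roofProfile; fun_prop

lemma isClosed_kite (a : Plane × ℝ) : IsClosed (kite i j α β δ a) :=
  isClosed_le continuous_const (continuous_roofProfile a)

lemma roof_nonneg (a : Plane × ℝ) (z : Plane) : 0 ≤ roof i j α β δ a z := le_max_left _ _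

lemma roof_eq_zero {a : Plane × ℝ} {z : Plane} (h : z ∉ kite i j α β δ a) :
    roof i j α β δ a z = 0 := max_eq_left (le_of_not_ge h)

/-- The constant does not depend on centre or height, so infinitely many tents can be glued without
losing the Lipschitz bound. -/
lemma roof_le_add (hα : 0 < α) (hβ : 0 < β) (hδ : 0 < δ) (a : Plane × ℝ) (y z : Plane) :
    roof i j α β δ a y ≤ roof i j α β δ a z + (α + β + δ) * dist y z := by
  have hi := abs_apply_sub_le_dist i y z
  have hj := abs_apply_sub_le_dist j y z
  have h0 := dist_nonneg (x := y) (y := z)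
  rw [abs_le] at hi
  have h1 : α * (y i - z i) ≤ α * dist y z := by gcongr; exact hi.2
  have h2 : β * (z i - y i) ≤ β * dist y z := by gcongr; linarith
  have h3 : δ * |z j - a.1 j| ≤ δ * |y j - a.1 j| + δ * dist y z := by
    rw [← mul_add]; gcongr
    have := abs_sub_le (z j) (y j) (a.1 j)
    rw [abs_sub_comm (z j) (y j)] at this
    linarith
  have h4 : 0 ≤ α * dist y z := by positivity
  have h5 : 0 ≤ β * dist y z := by positivity
  have h6 : 0 ≤ δ * dist y z := by positivity
  have h7 : min (a.2 + α * (y i - a.1 i)) (a.2 - β * (y i - a.1 i)) ≤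
      min (a.2 + α * (z i - a.1 i)) (a.2 - β * (z i - a.1 i)) + (α + β) * dist y z := by
    rw [← min_add_add_right]
    refine min_le_min ?_ ?_ <;> linarith
  refine max_le (by have := roof_nonneg (i := i) (j := j) (α := α) (β := β) (δ := δ) a z; nlinarith) ?_
  have h8 : roofProfile i j α β δ a z ≤ roof i j α β δ a z := le_max_right _ _
  unfold roofProfile at *
  linarith

/-- Together with `kite_subset_closedBall`, this bounds the eccentricity of kites uniformly in their
size, as Vitali's covering theorem requires. -/
lemma closedBall_subset_kite (hα : 0 < α) (hβ : 0 < β) (hδ : 0 < δ) (a : Plane × ℝ) :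
    Metric.closedBall a.1 (a.2 / (α + β + δ)) ⊆ kite i j α β δ a := by
  intro z hz
  have hz : dist z a.1 ≤ a.2 / (α + β + δ) := hz
  rw [le_div_iff₀ (by positivity)] at hz
  have hi := abs_le.1 (abs_apply_sub_le_dist i z a.1)
  have hj := abs_apply_sub_le_dist j z a.1
  have h0 := dist_nonneg (x := z) (y := a.1)
  have h3 : δ * |z j - a.1 j| ≤ δ * dist z a.1 := by gcongr
  have h4 : α * (-dist z a.1) ≤ α * (z i - a.1 i) := by gcongr; exact hi.1
  have h5 : β * (z i - a.1 i) ≤ β * dist z a.1 := by gcongr; exact hi.2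
  have h6 : 0 ≤ α * dist z a.1 := by positivity
  have h7 : 0 ≤ β * dist z a.1 := by positivity
  have : δ * dist z a.1 ≤ min (a.2 + α * (z i - a.1 i)) (a.2 - β * (z i - a.1 i)) :=
    le_min (by linarith) (by linarith)
  change 0 ≤ roofProfile i j α β δ a z
  unfold roofProfile
  linarith

lemma kite_subset_closedBall (hij : i ≠ j) (hα : 0 < α) (hβ : 0 < β) (hδ : 0 < δ)
    (a : Plane × ℝ) :
    kite i j α β δ a ⊆ Metric.closedBall a.1 (a.2 * (1 / α + 1 / β + 1 / δ)) := by
  intro z hz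
  have hz : 0 ≤ roofProfile i j α β δ a z := hz
  unfold roofProfile at hz
  have h1 := min_le_left (a.2 + α * (z i - a.1 i)) (a.2 - β * (z i - a.1 i))
  have h2 := min_le_right (a.2 + α * (z i - a.1 i)) (a.2 - β * (z i - a.1 i))
  have h3 : 0 ≤ δ * |z j - a.1 j| := by positivity
  have h4 : |z i - a.1 i| ≤ a.2 * (1 / α + 1 / β) := by
    rw [mul_add, mul_one_div, mul_one_div, abs_le]
    have e1 : -(a.2 / α) ≤ z i - a.1 i := by rw [← neg_div, div_le_iff₀ hα]; linarith
    have e2 : z i - a.1 i ≤ a.2 / β := by rw [le_div_iff₀ hβ]; linarith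
    have e0 : 0 ≤ a.2 := by
      rcases le_total 0 (z i - a.1 i) with h | h
      · nlinarith [mul_nonneg hβ.le h]
      · nlinarith [mul_nonneg hα.le (neg_nonneg.2 h)]
    have := div_nonneg e0 hα.le
    have := div_nonneg e0 hβ.le
    constructor <;> linarith
  have h5 : |z j - a.1 j| ≤ a.2 * (1 / δ) := by
    rw [mul_one_div, le_div_iff₀ hδ]
    rcases le_total 0 (z i - a.1 i) with h | h
    · nlinarith [mul_nonneg hβ.le h]
    · nlinarith [mul_nonneg hα.le (neg_nonneg.2 h)]
  rw [Metric.mem_closedBall, dist_eq_norm]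
  refine (norm_le_add_of_ne hij _).trans ?_
  simp only [PiLp.sub_apply]
  linarith

/-- The lines along which a tent may fail to be affine. -/
def kiteLines (i j : Fin 2) (α β δ : ℝ) (a : Plane × ℝ) : Set Plane :=
  {z | 1 * z i + 0 * z j = a.1 i} ∪ {z | 0 * z i + 1 * z j = a.1 j} ∪
    {z | α * z i + δ * z j = α * a.1 i + δ * a.1 j - a.2} ∪
    {z | α * z i + -δ * z j = α * a.1 i + -δ * a.1 j - a.2} ∪
    {z | β * z i + δ * z j = β * a.1 i + δ * a.1 j + a.2} ∪
    {z | β * z i + -δ * z j = β * a.1 i + -δ * a.1 j + a.2}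

lemma volume_kiteLines (hij : i ≠ j) (hδ : 0 < δ) (a : Plane × ℝ) :
    volume (kiteLines i j α β δ a) = 0 := by
  simp only [kiteLines, measure_union_null_iff]
  refine ⟨⟨⟨⟨⟨?_, ?_⟩, ?_⟩, ?_⟩, ?_⟩, ?_⟩ <;> apply volume_line_eq_zero hij
  · exact .inl one_ne_zero
  · exact .inr one_ne_zero
  · exact .inr hδ.ne'
  · exact .inr (neg_ne_zero.2 hδ.ne')
  · exact .inr hδ.ne'
  · exact .inr (neg_ne_zero.2 hδ.ne')

/-- The two lines through the centre carry the creases of the profile and the other four carry the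
edges of the kite. Away from them the profile is positive and both the minimum and the absolute
value are locally linear. -/
lemma roof_isAffineNear (hij : i ≠ j) (hα : 0 < α) (hβ : 0 < β) (hδ : 0 < δ) {a : Plane × ℝ}
    {z : Plane} (hz : z ∈ kite i j α β δ a) (hl : z ∉ kiteLines i j α β δ a) :
    kite i j α β δ a ∈ 𝓝 z ∧ ∃ ξ, IsAffineNear (roof i j α β δ a) z ξ ∧ |ξ j| ≤ δ ∧
      (ξ i = α ∨ ξ i = -β) := by
  simp only [kiteLines, Set.mem_union, Set.mem_ofPred_eq, not_or] at hl
  obtain ⟨⟨⟨⟨⟨l1, l2⟩, l3⟩, l4⟩, l5⟩, l6⟩ := hl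
  have hpos : 0 < roofProfile i j α β δ a z := by
    refine lt_of_le_of_ne hz fun h => ?_
    unfold roofProfile at h
    rcases min_choice (a.2 + α * (z i - a.1 i)) (a.2 - β * (z i - a.1 i)) with e | e <;>
    rcases abs_choice (z j - a.1 j) with e' | e' <;> rw [e, e'] at h
    · exact l4 (by linarith)
    · exact l3 (by linarith)
    · exact l5 (by linarith)
    · exact l6 (by linarith)
  have hopen : ∀ᶠ y in 𝓝 z, 0 < roofProfile i j α β δ a y :=
    (continuous_roofProfile a).continuousAt.eventually (lt_mem_nhds hpos)
  refine ⟨hopen.mono fun y hy => hy.le, ?_⟩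
  have hi : Continuous fun y : Plane => y i - a.1 i := by fun_prop
  have hj : Continuous fun y : Plane => y j - a.1 j := by fun_prop
  have sj : ∃ τ : ℝ, |τ| = 1 ∧ ∀ᶠ y : Plane in 𝓝 z, |y j - a.1 j| = τ * (y j - a.1 j) := by
    rcases lt_or_gt_of_ne (show z j - a.1 j ≠ 0 from fun h => l2 (by linarith)) with h | h
    · refine ⟨-1, by norm_num, ?_⟩
      filter_upwards [hj.continuousAt.eventually (gt_mem_nhds h)] with y hy
      rw [abs_of_neg hy]; ring
    · refine ⟨1, by norm_num, ?_⟩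
      filter_upwards [hj.continuousAt.eventually (lt_mem_nhds h)] with y hy
      rw [abs_of_pos hy]; ring
  have si : ∃ σ : ℝ, (σ = α ∨ σ = -β) ∧ ∀ᶠ y : Plane in 𝓝 z,
      min (a.2 + α * (y i - a.1 i)) (a.2 - β * (y i - a.1 i)) = a.2 + σ * (y i - a.1 i) := by
    rcases lt_or_gt_of_ne (show z i - a.1 i ≠ 0 from fun h => l1 (by linarith)) with h | h
    · refine ⟨α, .inl rfl, ?_⟩
      filter_upwards [hi.continuousAt.eventually (gt_mem_nhds h)] with y hy
      exact min_eq_left (by nlinarith)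
    · refine ⟨-β, .inr rfl, ?_⟩
      filter_upwards [hi.continuousAt.eventually (lt_mem_nhds h)] with y hy
      rw [min_eq_right (by nlinarith)]; ring
  obtain ⟨τ, hτ, hτ'⟩ := sj
  obtain ⟨σ, hσ, hσ'⟩ := si
  refine ⟨vec i j σ (-δ * τ), ⟨a.2 - σ * a.1 i + δ * τ * a.1 j, ?_⟩, ?_, ?_⟩
  · filter_upwards [hopen, hτ', hσ'] with y h1 h2 h3
    rw [roof, max_eq_right h1.le, roofProfile, h2, h3, inner_eq_of_ne hij, vec_fst hij, vec_snd hij]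
    ring
  · rw [vec_snd hij, abs_mul, hτ, abs_neg, abs_of_pos hδ, mul_one]
  · rwa [vec_fst hij]

end

/-- Uniformly Lipschitz nonnegative functions supported on disjoint sets glue to a Lipschitz
function. -/
lemma exists_glue {ι : Type*} (t : Set ι) (B : ι → Set Plane) (f : ι → Plane → ℝ)
    (hd : t.PairwiseDisjoint B) (hf : ∀ a z, 0 ≤ f a z) (hf0 : ∀ a, ∀ z ∉ B a, f a z = 0)
    (K : NNReal) (hK : ∀ a y z, f a y ≤ f a z + K * dist y z) :
    ∃ h : Plane → ℝ, LipschitzWith K h ∧ (∀ a ∈ t, ∀ z ∈ B a, h z = f a z) ∧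
      (∀ z, 0 ≤ h z) ∧ ∀ z, (∀ a ∈ t, z ∉ B a) → h z = 0 := by
  classical
  let h : Plane → ℝ := fun z => if H : ∃ a ∈ t, z ∈ B a then f H.choose z else 0
  have h1 : ∀ a ∈ t, ∀ z ∈ B a, h z = f a z := by
    intro a ha z hz
    have H : ∃ a ∈ t, z ∈ B a := ⟨a, ha, hz⟩
    have : H.choose = a := hd.elim_set H.choose_spec.1 ha z H.choose_spec.2 hz
    simp only [h, dif_pos H, this]
  have h2 : ∀ z, (∀ a ∈ t, z ∉ B a) → h z = 0 := by
    intro z hz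
    exact dif_neg fun ⟨a, ha, hz'⟩ => hz a ha hz'
  have h3 : ∀ z, 0 ≤ h z := by
    intro z
    by_cases H : ∃ a ∈ t, z ∈ B a
    · obtain ⟨a, ha, hz⟩ := H
      rw [h1 a ha z hz]; exact hf a z
    · rw [h2 z (by simpa using H)]
  -- Nonnegativity makes every single piece a lower bound for the glued function, so a one-sided
  -- estimate on the piece containing y suffices, wherever z lies.
  have h4 : ∀ a ∈ t, ∀ z, f a z ≤ h z := by
    intro a ha z
    by_cases hz : z ∈ B a
    · rw [h1 a ha z hz]
    · rw [hf0 a z hz]; exact h3 z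
  refine ⟨h, LipschitzWith.of_le_add_mul K fun y z => ?_, h1, h3, h2⟩
  by_cases H : ∃ a ∈ t, y ∈ B a
  · obtain ⟨a, ha, hy⟩ := H
    rw [h1 a ha y hy]
    exact (hK a y z).trans (by gcongr; exact h4 a ha z)
  · rw [h2 y (by simpa using H)]
    have := h3 z
    positivity

/-- This yields the volume ratio of the two phases of a laminate without computing the area of any
kite. -/
lemma integral_lineDeriv_eq_zero {h : Plane → ℝ} {K : NNReal} (hh : LipschitzWith K h)
    (hc : HasCompactSupport h) (v : Plane) : ∫ z, lineDeriv ℝ h z v = 0 := by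
  have := LipschitzWith.integral_lineDeriv_mul_eq (μ := (volume : Measure Plane))
    (LipschitzWith.const (1 : ℝ)) hh hc (-v)
  simpa [lineDeriv] using this.symm

/-- Basic one-directional lamination: on any bounded open set there is a Lipschitz function with
zero boundary values whose derivative in direction `i` takes exactly the two values `α` and `-β`,
while its derivative in direction `j` is at most `δ`. -/
lemma exists_laminate {i j : Fin 2} (hij : i ≠ j) {Ω : Set Plane} (hΩ : IsOpen Ω)
    (hb : Bornology.IsBounded Ω) {α β δ : ℝ} (hα : 0 < α) (hβ : 0 < β) (hδ : 0 < δ) :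
    ∃ h : Plane → ℝ, (∃ K, LipschitzWith K h) ∧ (∀ z ∉ Ω, h z = 0) ∧
      ∃ G₁ G₂ : Set Plane, IsOpen G₁ ∧ IsOpen G₂ ∧ G₁ ⊆ Ω ∧ G₂ ⊆ Ω ∧ Disjoint G₁ G₂ ∧
        volume (Ω \ (G₁ ∪ G₂)) = 0 ∧ α * volume.real G₁ = β * volume.real G₂ ∧
        (∀ z ∈ G₁, ∃ ξ, IsAffineNear h z ξ ∧ ξ i = α ∧ |ξ j| ≤ δ) ∧
        (∀ z ∈ G₂, ∃ ξ, IsAffineNear h z ξ ∧ ξ i = -β ∧ |ξ j| ≤ δ) := by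
  set R : ℝ := 1 / α + 1 / β + 1 / δ with hR
  have hR0 : 0 < R := by positivity
  set K : NNReal := ⟨α + β + δ, by positivity⟩ with hK
  let t : Set (Plane × ℝ) := {a | 0 < a.2 ∧ Metric.closedBall a.1 (a.2 * R) ⊆ Ω}
  obtain ⟨C, hC⟩ : ∃ C : NNReal, ∀ a ∈ t, volume (Metric.closedBall a.1 (3 * (a.2 * R))) ≤
      C * volume (kite i j α β δ a) := by
    -- The square, in dimension two, of the ratio between the enlarged outer radius 3·a.2·R and the
    -- inner radius a.2/(α + β + δ).
    refine ⟨Real.toNNReal ((3 * R * (α + β + δ)) ^ 2), fun a ha => ?_⟩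
    calc volume (Metric.closedBall a.1 (3 * (a.2 * R)))
        = ENNReal.ofReal ((3 * R * (α + β + δ)) ^ 2) *
            volume (Metric.closedBall a.1 (a.2 / (α + β + δ))) := by
          have h1 := ha.1
          rw [Measure.addHaar_closedBall _ _ (by positivity),
            Measure.addHaar_closedBall _ _ (by positivity), ← mul_assoc (ENNReal.ofReal _),
            ← ENNReal.ofReal_mul (by positivity)]
          congr 2
          simp only [finrank_euclideanSpace, Fintype.card_fin]
          field_simp
      _ ≤ _ := by
          gcongr
          · rfl
          · exact closedBall_subset_kite hα hβ hδ a
  obtain ⟨s, hst, hsc, hsd, hs0⟩ := Vitali.exists_disjoint_covering_ae volume Ω t C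
    (fun a => a.2 * R) (fun a => a.1) (kite i j α β δ)
    (fun a _ => kite_subset_closedBall hij hα hβ hδ a) hC
    (fun a ha => ⟨a.1, mem_interior_iff_mem_nhds.2 <| mem_of_superset
      (Metric.closedBall_mem_nhds a.1 (div_pos ha.1 (by positivity)))
      (closedBall_subset_kite hα hβ hδ a)⟩)
    (fun a _ => isClosed_kite a)
    (by
      intro x hx ε hε
      obtain ⟨r, hr, hrΩ⟩ := Metric.nhds_basis_closedBall.mem_iff.1 (hΩ.mem_nhds hx)
      have h1 : min ε r / R * R = min ε r := div_mul_cancel₀ _ hR0.ne'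
      refine ⟨(x, min ε r / R), ⟨?_, ?_⟩, ?_, rfl⟩
      · have := lt_min hε hr
        positivity
      · simp only [h1]
        exact (Metric.closedBall_subset_closedBall (min_le_right _ _)).trans hrΩ
      · simp only [h1]; exact min_le_left _ _)
  obtain ⟨h, hL, h1, hpos, h2⟩ := exists_glue s (kite i j α β δ) (roof i j α β δ) hsd
    (fun a z => roof_nonneg a z) (fun a z hz => roof_eq_zero hz) K
    (fun a y z => roof_le_add hα hβ hδ a y z)
  have hkΩ : ∀ a ∈ s, kite i j α β δ a ⊆ Ω := fun a ha =>
    (kite_subset_closedBall hij hα hβ hδ a).trans (hst ha).2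
  have h0 : ∀ z ∉ Ω, h z = 0 := fun z hz => h2 z fun a ha hza => hz (hkΩ a ha hza)
  have hcomp : HasCompactSupport h :=
    HasCompactSupport.of_support_subset_isCompact hb.isCompact_closure fun z hz =>
      subset_closure (by_contra fun hzΩ => hz (h0 z hzΩ))
  -- Defining the phases through the local gradient of h, not as unions of half-kites, makes
  -- openness and disjointness immediate.
  set G₁ : Set Plane := Ω ∩ {z | ∃ ξ, IsAffineNear h z ξ ∧ ξ i = α ∧ |ξ j| ≤ δ} with hG₁
  set G₂ : Set Plane := Ω ∩ {z | ∃ ξ, IsAffineNear h z ξ ∧ ξ i = -β ∧ |ξ j| ≤ δ} with hG₂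
  have o1 : IsOpen G₁ := hΩ.inter (isOpen_setOf_affineNear h fun ξ => ξ i = α ∧ |ξ j| ≤ δ)
  have o2 : IsOpen G₂ := hΩ.inter (isOpen_setOf_affineNear h fun ξ => ξ i = -β ∧ |ξ j| ≤ δ)
  have hdis : Disjoint G₁ G₂ := by
    rw [Set.disjoint_left]
    rintro z ⟨-, ξ, hξ, e1, -⟩ ⟨-, ζ, hζ, e2, -⟩
    have := hξ.gradient_eq.symm.trans hζ.gradient_eq
    rw [this] at e1
    linarith
  have hnull : volume (Ω \ (G₁ ∪ G₂)) = 0 := by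
    refine measure_mono_null (t := (Ω \ ⋃ a ∈ s, kite i j α β δ a) ∪
      ⋃ a ∈ s, kiteLines i j α β δ a) ?_ ?_
    · rintro z ⟨hzΩ, hz⟩
      by_contra hcon
      simp only [Set.mem_union, Set.mem_sdiff, hzΩ, true_and, Set.mem_iUnion, not_or,
        not_exists] at hcon
      obtain ⟨hk, hlines⟩ := hcon
      push Not at hk
      obtain ⟨a, ha, hza⟩ := hk
      obtain ⟨hn, ξ, hξ, hj, hi⟩ := roof_isAffineNear hij hα hβ hδ hza (hlines a ha)
      have hξ' : IsAffineNear h z ξ := hξ.congr (by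
        filter_upwards [hn] with y hy using h1 a ha y hy)
      rcases hi with hi | hi
      · exact hz (.inl ⟨hzΩ, ξ, hξ', hi, hj⟩)
      · exact hz (.inr ⟨hzΩ, ξ, hξ', hi, hj⟩)
    · rw [measure_union_null_iff]
      exact ⟨hs0, (measure_biUnion_null_iff hsc).2 fun a _ => volume_kiteLines hij hδ a⟩
  refine ⟨h, ⟨K, hL⟩, h0, G₁, G₂, o1, o2, Set.inter_subset_left, Set.inter_subset_left, hdis,
    hnull, ?_, fun z hz => hz.2, fun z hz => hz.2⟩
  have hfin : ∀ G ⊆ Ω, volume G ≠ ⊤ := fun G hG =>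
    (measure_mono hG |>.trans_lt hb.measure_lt_top).ne
  have hld : ∀ z ξ, IsAffineNear h z ξ → lineDeriv ℝ h z (EuclideanSpace.single i 1) = ξ i := by
    intro z ξ hξ
    have := hξ.hasGradientAt.hasFDerivAt.hasLineDerivAt (EuclideanSpace.single i (1 : ℝ))
    rw [this.lineDeriv]
    simp [EuclideanSpace.inner_single_right]
  have hae : (fun z => lineDeriv ℝ h z (EuclideanSpace.single i 1)) =ᵐ[volume]
      fun z => G₁.indicator (fun _ => α) z + G₂.indicator (fun _ => -β) z := by
    filter_upwards [compl_mem_ae_iff.2 hnull] with z hz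
    by_cases m1 : z ∈ G₁
    · obtain ⟨ξ, hξ, e, -⟩ := m1.2
      rw [hld z ξ hξ, Set.indicator_of_mem m1,
        Set.indicator_of_notMem (Set.disjoint_left.1 hdis m1), e, add_zero]
    by_cases m2 : z ∈ G₂
    · obtain ⟨ξ, hξ, e, -⟩ := m2.2
      rw [hld z ξ hξ, Set.indicator_of_mem m2, Set.indicator_of_notMem m1, e, zero_add]
    rw [Set.indicator_of_notMem m1, Set.indicator_of_notMem m2, add_zero]
    have hzΩ : z ∉ Ω := fun hzΩ => hz ⟨hzΩ, fun hm => hm.elim m1 m2⟩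
    -- Off Ω the nonnegative h vanishes, hence is minimal; this covers the boundary of Ω too, which
    -- may have positive measure.
    refine IsLocalMin.deriv_eq_zero (Eventually.of_forall fun r => ?_)
    simpa [h0 z hzΩ] using hpos _
  have hI := integral_lineDeriv_eq_zero hL hcomp (EuclideanSpace.single i (1 : ℝ))
  rw [integral_congr_ae hae, integral_add, integral_indicator_const _ o1.measurableSet,
    integral_indicator_const _ o2.measurableSet] at hI
  · simp only [smul_eq_mul] at hI
    linarith
  · exact (integrable_indicator_iff o1.measurableSet).2
      (integrableOn_const (hfin _ Set.inter_subset_left))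
  · exact (integrable_indicator_iff o2.measurableSet).2
      (integrableOn_const (hfin _ Set.inter_subset_left))

section

variable {i j : Fin 2} {u : Plane → ℝ} {T : Set Plane} {a a₁ a₂ η η' : ℝ}

/-- Adding to u a laminate with slopes a₁ − a and −(a − a₂) moves the value a to a₁ or a₂; its
transverse slope η' − η uses up the allowed growth. -/
lemma exists_split_of_lt (hij : i ≠ j) (hL : ∃ K, LipschitzWith K u) (hT : IsOpen T)
    (hb : Bornology.IsBounded T) (hη : η < η')
    (hu : ∀ z ∈ T, ∃ ξ, IsAffineNear u z ξ ∧ ξ i = a ∧ |ξ j| ≤ η) (h₁ : a < a₁) (h₂ : a₂ < a) :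
    ∃ u' : Plane → ℝ, (∃ K, LipschitzWith K u') ∧ (∀ z ∉ T, u' z = u z) ∧
      ∃ T₁ T₂ : Set Plane, IsOpen T₁ ∧ IsOpen T₂ ∧ T₁ ⊆ T ∧ T₂ ⊆ T ∧ Disjoint T₁ T₂ ∧
        volume (T \ (T₁ ∪ T₂)) = 0 ∧ (a₁ - a) * volume.real T₁ = (a - a₂) * volume.real T₂ ∧
        (∀ z ∈ T₁, ∃ ξ, IsAffineNear u' z ξ ∧ ξ i = a₁ ∧ |ξ j| ≤ η') ∧
        (∀ z ∈ T₂, ∃ ξ, IsAffineNear u' z ξ ∧ ξ i = a₂ ∧ |ξ j| ≤ η') := by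
  obtain ⟨h, ⟨K', hK'⟩, h0, T₁, T₂, o1, o2, s1, s2, hd, hn, hv, a1, a2⟩ :=
    exists_laminate hij hT hb (sub_pos.2 h₁) (sub_pos.2 h₂) (sub_pos.2 hη)
  obtain ⟨K, hK⟩ := hL
  refine ⟨fun z => u z + h z, ⟨_, hK.add hK'⟩, fun z hz => by simp [h0 z hz], T₁, T₂, o1, o2, s1,
    s2, hd, hn, hv, fun z hz => ?_, fun z hz => ?_⟩
  · obtain ⟨ξ, hξ, e1, e2⟩ := hu z (s1 hz)
    obtain ⟨ζ, hζ, f1, f2⟩ := a1 z hz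
    refine ⟨ξ + ζ, hξ.add hζ, by rw [PiLp.add_apply, e1, f1]; ring, ?_⟩
    rw [PiLp.add_apply]
    linarith [abs_add_le (ξ j) (ζ j)]
  · obtain ⟨ξ, hξ, e1, e2⟩ := hu z (s2 hz)
    obtain ⟨ζ, hζ, f1, f2⟩ := a2 z hz
    refine ⟨ξ + ζ, hξ.add hζ, by rw [PiLp.add_apply, e1, f1]; ring, ?_⟩
    rw [PiLp.add_apply]
    linarith [abs_add_le (ξ j) (ζ j)]

lemma measureReal_add_of_split {T T₁ T₂ : Set Plane} (hb : Bornology.IsBounded T)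
    (o2 : IsOpen T₂) (s1 : T₁ ⊆ T) (s2 : T₂ ⊆ T) (hd : Disjoint T₁ T₂)
    (hn : volume (T \ (T₁ ∪ T₂)) = 0) :
    volume.real T₁ + volume.real T₂ = volume.real T := by
  have hfin : ∀ G ⊆ T, volume G ≠ ⊤ := fun G hG => (measure_mono hG |>.trans_lt hb.measure_lt_top).ne
  rw [← measureReal_union hd o2.measurableSet (hfin _ s1) (hfin _ s2)]
  refine measureReal_congr ?_
  exact (LE.le.eventuallyLE (Set.union_subset s1 s2)).antisymm
    (ae_le_set.2 hn)

/-- Splitting the value `a` of the derivative in direction `i` on `T` into `a₁` and `a₂`. -/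
lemma exists_split (hij : i ≠ j) (hL : ∃ K, LipschitzWith K u) (hT : IsOpen T)
    (hb : Bornology.IsBounded T) (hη : η < η')
    (hu : ∀ z ∈ T, ∃ ξ, IsAffineNear u z ξ ∧ ξ i = a ∧ |ξ j| ≤ η)
    (h : 0 < (a₁ - a) * (a - a₂)) :
    ∃ u' : Plane → ℝ, (∃ K, LipschitzWith K u') ∧ (∀ z ∉ T, u' z = u z) ∧
      ∃ T₁ T₂ : Set Plane, IsOpen T₁ ∧ IsOpen T₂ ∧ T₁ ⊆ T ∧ T₂ ⊆ T ∧ Disjoint T₁ T₂ ∧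
        volume (T \ (T₁ ∪ T₂)) = 0 ∧
        volume.real T₁ = (a - a₂) / (a₁ - a₂) * volume.real T ∧
        (∀ z ∈ T₁, ∃ ξ, IsAffineNear u' z ξ ∧ ξ i = a₁ ∧ |ξ j| ≤ η') ∧
        (∀ z ∈ T₂, ∃ ξ, IsAffineNear u' z ξ ∧ ξ i = a₂ ∧ |ξ j| ≤ η') := by
  rcases pos_and_pos_or_neg_and_neg_of_mul_pos h with ⟨p1, p2⟩ | ⟨p1, p2⟩
  · obtain ⟨u', hL', he, T₁, T₂, o1, o2, s1, s2, hd, hn, hv, a1, a2⟩ :=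
      exists_split_of_lt hij hL hT hb hη hu (sub_pos.1 p1) (sub_pos.1 p2)
    refine ⟨u', hL', he, T₁, T₂, o1, o2, s1, s2, hd, hn, ?_, a1, a2⟩
    have := measureReal_add_of_split hb o2 s1 s2 hd hn
    have h0 : a₁ - a₂ ≠ 0 := by linarith
    rw [← this]
    field_simp
    linarith
  · obtain ⟨u', hL', he, T₂, T₁, o2, o1, s2, s1, hd, hn, hv, a2, a1⟩ :=
      exists_split_of_lt hij hL hT hb hη hu (sub_neg.1 p2) (sub_neg.1 p1)
    refine ⟨u', hL', he, T₁, T₂, o1, o2, s1, s2, hd.symm, by rwa [Set.union_comm], ?_, a1, a2⟩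
    have := measureReal_add_of_split hb o1 s2 s1 hd hn
    have h0 : a₁ - a₂ ≠ 0 := by linarith
    rw [← this]
    field_simp
    linarith

end

/-! ### Stages of the lamination and the two elementary moves. -/

/-- A stage of the lamination inside `Ω`: the pair `(u, v)` agrees with `(u₀, v₀)` off `Ω`; up to a
null set `Ω` splits into `D`, where the pair of gradients is `good`, and `T`, where `∂₁ u = x`,
`∂₂ v = -y`, and the other derivatives are at most `η`. The proportion of `T` is at most `m`. -/
structure IsStage (Ω : Set Plane) (u₀ v₀ : Plane → ℝ) (good : Plane → Plane → Prop)
    (x y m η : ℝ) (u v : Plane → ℝ) (T D : Set Plane) : Prop where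
  lip_u : ∃ K, LipschitzWith K u
  lip_v : ∃ K, LipschitzWith K v
  eq_u : ∀ z ∉ Ω, u z = u₀ z
  eq_v : ∀ z ∉ Ω, v z = v₀ z
  isOpen_T : IsOpen T
  isOpen_D : IsOpen D
  T_subset : T ⊆ Ω
  D_subset : D ⊆ Ω
  disj : Disjoint T D
  null : volume (Ω \ (T ∪ D)) = 0
  measure_le : volume.real T ≤ m * volume.real Ω
  on_T : ∀ z ∈ T, ∃ ξ ζ, IsAffineNear u z ξ ∧ IsAffineNear v z ζ ∧
    ξ 0 = x ∧ ζ 1 = -y ∧ |ξ 1| ≤ η ∧ |ζ 0| ≤ η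
  on_D : ∀ z ∈ D, ∃ ξ ζ, IsAffineNear u z ξ ∧ IsAffineNear v z ζ ∧ good ξ ζ

/-- There is a stage of the lamination with the given parameters. -/
def HasStage (Ω : Set Plane) (u₀ v₀ : Plane → ℝ) (good : Plane → Plane → Prop)
    (x y m η : ℝ) : Prop :=
  ∃ u v T D, IsStage Ω u₀ v₀ good x y m η u v T D

lemma eventuallyEq_of_disjoint {u u' : Plane → ℝ} {T D : Set Plane} (h : ∀ z ∉ T, u' z = u z)
    (hD : IsOpen D) (hd : Disjoint T D) {z : Plane} (hz : z ∈ D) : u' =ᶠ[𝓝 z] u := by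
  filter_upwards [hD.mem_nhds hz] with y hy using h y (Set.disjoint_right.1 hd hy)

lemma volume_diff_of_split {Ω T D T₁ T₂ : Set Plane} (h : volume (Ω \ (T ∪ D)) = 0)
    (hn : volume (T \ (T₁ ∪ T₂)) = 0) : volume (Ω \ (T₁ ∪ (D ∪ T₂))) = 0 := by
  refine measure_mono_null (t := (Ω \ (T ∪ D)) ∪ (T \ (T₁ ∪ T₂))) ?_
    (measure_union_null_iff.2 ⟨h, hn⟩)
  rintro z ⟨hz, hz'⟩
  simp only [Set.mem_union, Set.mem_sdiff] at *
  tauto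

namespace HasStage

variable {Ω : Set Plane} {u₀ v₀ : Plane → ℝ} {good : Plane → Plane → Prop} {x y m η : ℝ}

lemma mono (h : HasStage Ω u₀ v₀ good x y m η) {m' η' : ℝ} (hm : m ≤ m') (hη : η ≤ η') :
    HasStage Ω u₀ v₀ good x y m' η' := by
  obtain ⟨u, v, T, D, H⟩ := h
  refine ⟨u, v, T, D, { H with measure_le := H.measure_le.trans (by gcongr), on_T := ?_ }⟩
  intro z hz
  obtain ⟨ξ, ζ, h1, h2, h3, h4, h5, h6⟩ := H.on_T z hz
  exact ⟨ξ, ζ, h1, h2, h3, h4, h5.trans hη, h6.trans hη⟩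

lemma init (hu : ∃ K, LipschitzWith K u₀) (hv : ∃ K, LipschitzWith K v₀) (hΩ : IsOpen Ω)
    (h : ∀ z ∈ Ω, ∃ ξ ζ, IsAffineNear u₀ z ξ ∧ IsAffineNear v₀ z ζ ∧
      ξ 0 = x ∧ ζ 1 = -y ∧ |ξ 1| ≤ η ∧ |ζ 0| ≤ η) :
    HasStage Ω u₀ v₀ good x y 1 η :=
  ⟨u₀, v₀, Ω, ∅, hu, hv, fun _ _ => rfl, fun _ _ => rfl, hΩ, isOpen_empty, subset_rfl,
    Set.empty_subset _, Set.disjoint_empty _, by simp, by simp, h, fun z hz => hz.elim⟩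

/-- Only u changes: the part with ∂₁u = w joins the finished set and the part with x' stays
unfinished. The product condition places x strictly between w and x' in either order, which serves
both signs of the staircase. -/
lemma horizontal (hb : Bornology.IsBounded Ω) (h : HasStage Ω u₀ v₀ good x y m η) {η' x' w : ℝ}
    (hη : η < η') (hx : 0 < (x' - x) * (x - w))
    (hgood : ∀ ξ ζ : Plane, ξ 0 = w → ζ 1 = -y → |ξ 1| ≤ η' → |ζ 0| ≤ η' → good ξ ζ) :
    HasStage Ω u₀ v₀ good x' y (m * ((x - w) / (x' - w))) η' := by
  obtain ⟨u, v, T, D, H⟩ := h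
  obtain ⟨u', hL, he, T₁, T₂, o1, o2, s1, s2, hd, hn, hm, a1, a2⟩ :=
    exists_split (i := 0) (j := 1) (by decide) H.lip_u H.isOpen_T (hb.subset H.T_subset) hη
      (fun z hz => by
        obtain ⟨ξ, ζ, h1, h2, h3, h4, h5, h6⟩ := H.on_T z hz
        exact ⟨ξ, h1, h3, h5⟩) hx
  have hfrac : 0 ≤ (x - w) / (x' - w) := by
    rcases pos_and_pos_or_neg_and_neg_of_mul_pos hx with ⟨p1, p2⟩ | ⟨p1, p2⟩
    · exact div_nonneg p2.le (by linarith)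
    · exact div_nonneg_of_nonpos p2.le (by linarith)
  refine ⟨u', v, T₁, D ∪ T₂, hL, H.lip_v, fun z hz => ?_, H.eq_v, o1, H.isOpen_D.union o2,
    s1.trans H.T_subset, Set.union_subset H.D_subset (s2.trans H.T_subset), ?_,
    volume_diff_of_split H.null hn, ?_, fun z hz => ?_, fun z hz => ?_⟩
  · rw [he z fun hzT => hz (H.T_subset hzT), H.eq_u z hz]
  · exact Set.disjoint_union_right.2 ⟨H.disj.mono_left s1, hd⟩
  · rw [hm]
    calc _ ≤ (x - w) / (x' - w) * (m * volume.real Ω) := by gcongr; exact H.measure_le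
      _ = _ := by ring
  · obtain ⟨ξ, hξ, e1, e2⟩ := a1 z hz
    obtain ⟨-, ζ, -, h2, -, h4, -, h6⟩ := H.on_T z (s1 hz)
    exact ⟨ξ, ζ, hξ, h2, e1, h4, e2, h6.trans hη.le⟩
  · rcases hz with hz | hz
    · obtain ⟨ξ, ζ, h1, h2, h3⟩ := H.on_D z hz
      exact ⟨ξ, ζ, h1.congr (eventuallyEq_of_disjoint he H.isOpen_D H.disj hz), h2, h3⟩
    · obtain ⟨ξ, hξ, e1, e2⟩ := a2 z hz
      obtain ⟨-, ζ, -, h2, -, h4, -, h6⟩ := H.on_T z (s2 hz)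
      exact ⟨ξ, ζ, hξ, h2, hgood ξ ζ e1 h4 e2 (h6.trans hη.le)⟩

lemma vertical (hb : Bornology.IsBounded Ω) (h : HasStage Ω u₀ v₀ good x y m η) {η' y' w : ℝ}
    (hη : η < η') (hy : 0 < (y' - y) * (y - w))
    (hgood : ∀ ξ ζ : Plane, ξ 0 = x → ζ 1 = -w → |ξ 1| ≤ η' → |ζ 0| ≤ η' → good ξ ζ) :
    HasStage Ω u₀ v₀ good x y' (m * ((y - w) / (y' - w))) η' := by
  obtain ⟨u, v, T, D, H⟩ := h
  obtain ⟨v', hL, he, T₁, T₂, o1, o2, s1, s2, hd, hn, hm, a1, a2⟩ :=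
    exists_split (i := 1) (j := 0) (a := -y) (a₁ := -y') (a₂ := -w) (by decide) H.lip_v
      H.isOpen_T (hb.subset H.T_subset) hη
      (fun z hz => by
        obtain ⟨ξ, ζ, h1, h2, h3, h4, h5, h6⟩ := H.on_T z hz
        exact ⟨ζ, h2, h4, h6⟩) (by linarith)
  have hfrac : 0 ≤ (y - w) / (y' - w) := by
    rcases pos_and_pos_or_neg_and_neg_of_mul_pos hy with ⟨p1, p2⟩ | ⟨p1, p2⟩
    · exact div_nonneg p2.le (by linarith)
    · exact div_nonneg_of_nonpos p2.le (by linarith)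
  refine ⟨u, v', T₁, D ∪ T₂, H.lip_u, hL, H.eq_u, fun z hz => ?_, o1, H.isOpen_D.union o2,
    s1.trans H.T_subset, Set.union_subset H.D_subset (s2.trans H.T_subset), ?_,
    volume_diff_of_split H.null hn, ?_, fun z hz => ?_, fun z hz => ?_⟩
  · rw [he z fun hzT => hz (H.T_subset hzT), H.eq_v z hz]
  · exact Set.disjoint_union_right.2 ⟨H.disj.mono_left s1, hd⟩
  · have e : (-y - -w) / (-y' - -w) = (y - w) / (y' - w) := by
      rw [← neg_div_neg_eq]; congr 1 <;> ring
    rw [hm, e]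
    calc _ ≤ (y - w) / (y' - w) * (m * volume.real Ω) := by gcongr; exact H.measure_le
      _ = _ := by ring
  · obtain ⟨ζ, hζ, e1, e2⟩ := a1 z hz
    obtain ⟨ξ, -, h1, -, h3, -, h5, -⟩ := H.on_T z (s1 hz)
    exact ⟨ξ, ζ, h1, hζ, h3, e1, h5.trans hη.le, e2⟩
  · rcases hz with hz | hz
    · obtain ⟨ξ, ζ, h1, h2, h3⟩ := H.on_D z hz
      exact ⟨ξ, ζ, h1, h2.congr (eventuallyEq_of_disjoint he H.isOpen_D H.disj hz), h3⟩
    · obtain ⟨ζ, hζ, e1, e2⟩ := a2 z hz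
      obtain ⟨ξ, -, h1, -, h3, -, h5, -⟩ := H.on_T z (s2 hz)
      exact ⟨ξ, ζ, h1, hζ, hgood ξ ζ h3 e1 (h5.trans hη.le) e2⟩

end HasStage

/-! ### Staircases adapted to the oscillating graph of `amp`. -/

/-- One component of the nonlinearity `A`. -/
def amp (θ t : ℝ) : ℝ := (1 + √θ * Real.sin (Real.pi * t)) * t

/-- Pairs of gradients `(∇u, ∇v)` for which `A(∇u) - ∇^⊥ v` is at most a constant, while `∇u` is
at least `R`. -/
def IsGood (θ R : ℝ) (ξ ζ : Plane) : Prop :=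
  R ≤ |ξ 0| ∧ |amp θ (ξ 0) + ζ 1| ≤ 4 ∧ |ξ 1| ≤ 1 ∧ |ζ 0| ≤ 1

/-- The parameters of a staircase: the unfinished values are `(ε X n, -ε c n)`, the finished ones
`-ε W n` and `ε σ X n`, and `M n` bounds the unfinished mass. -/
structure IsStaircase (θ R ε σ : ℝ) (X c W M : ℕ → ℝ) : Prop where
  sign : ε = 1 ∨ ε = -1
  σ_pos : 0 < σ
  X_pos : ∀ n, 0 < X n
  c_pos : ∀ n, 0 < c n
  W_pos : ∀ n, 0 < W n
  X_lt : ∀ n, X n < X (n + 1)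
  c_lt : ∀ n, c n < c (n + 1)
  le_X : ∀ n, R ≤ X n
  le_W : ∀ n, R ≤ W n
  amp_X : ∀ n, amp θ (ε * X n) = ε * (σ * X n)
  amp_W : ∀ n, |amp θ (-(ε * W n)) + ε * c n| ≤ 4
  M_zero : M 0 = 1
  M_nonneg : ∀ n, 0 ≤ M n
  M_succ : ∀ n, M n * ((X n + W n) / (X (n + 1) + W n)) *
    ((c n + σ * X (n + 1)) / (c (n + 1) + σ * X (n + 1))) ≤ M (n + 1)

namespace IsStaircase

variable {θ R ε σ : ℝ} {X c W M : ℕ → ℝ} {Ω : Set Plane} {u₀ v₀ : Plane → ℝ}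

lemma abs_sign (h : IsStaircase θ R ε σ X c W M) : |ε| = 1 := by
  rcases h.sign with e | e <;> simp [e]

lemma sign_mul_self (h : IsStaircase θ R ε σ X c W M) : ε * ε = 1 := by
  rcases h.sign with e | e <;> simp [e]

lemma sign_div (h : IsStaircase θ R ε σ X c W M) (p q : ℝ) : ε * p / (ε * q) = p / q :=
  mul_div_mul_left _ _ (by rcases h.sign with e | e <;> simp [e])

lemma good_X (h : IsStaircase θ R ε σ X c W M) (n : ℕ) {η : ℝ} (hη : η ≤ 1) (ξ ζ : Plane)
    (h1 : ξ 0 = ε * X n) (h2 : ζ 1 = -(ε * (σ * X n))) (h3 : |ξ 1| ≤ η) (h4 : |ζ 0| ≤ η) :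
    IsGood θ R ξ ζ := by
  refine ⟨?_, ?_, h3.trans hη, h4.trans hη⟩
  · rw [h1, abs_mul, h.abs_sign, one_mul, abs_of_pos (h.X_pos n)]; exact h.le_X n
  · rw [h1, h2, h.amp_X]; simp

lemma good_W (h : IsStaircase θ R ε σ X c W M) (n : ℕ) {η : ℝ} (hη : η ≤ 1) (ξ ζ : Plane)
    (h1 : ξ 0 = -(ε * W n)) (h2 : ζ 1 = -(-(ε * c n))) (h3 : |ξ 1| ≤ η) (h4 : |ζ 0| ≤ η) :
    IsGood θ R ξ ζ := by
  refine ⟨?_, ?_, h3.trans hη, h4.trans hη⟩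
  · rw [h1, abs_neg, abs_mul, h.abs_sign, one_mul, abs_of_pos (h.W_pos n)]; exact h.le_W n
  · rw [h1, h2, neg_neg]; exact h.amp_W n

/-- The staircase is entered from the axis y = 0, where v is still zero, by one vertical split;
bounding the surviving proportion by 1 is enough. -/
lemma hasStage_zero (h : IsStaircase θ R ε σ X c W M) (hb : Bornology.IsBounded Ω) {η η' : ℝ}
    (h0 : HasStage Ω u₀ v₀ (IsGood θ R) (ε * X 0) 0 1 η) (hη : η < η') (hη' : η' ≤ 1) :
    HasStage Ω u₀ v₀ (IsGood θ R) (ε * X 0) (-(ε * c 0)) (M 0) η' := by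
  have hc := h.c_pos 0
  have hX := mul_pos h.σ_pos (h.X_pos 0)
  have e : (0 - ε * (σ * X 0)) / (-(ε * c 0) - ε * (σ * X 0)) =
      σ * X 0 / (c 0 + σ * X 0) := by
    rw [← h.sign_div (σ * X 0), ← neg_div_neg_eq]; congr 1 <;> ring
  have := h0.vertical hb (y' := -(ε * c 0)) (w := ε * (σ * X 0)) hη ?_ (h.good_X 0 hη')
  · refine this.mono ?_ le_rfl
    rw [e, h.M_zero, one_mul, div_le_one (by positivity)]
    linarith
  · have : (-(ε * c 0) - 0) * (0 - ε * (σ * X 0)) = (ε * ε) * (c 0 * (σ * X 0)) := by ring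
    rw [this, h.sign_mul_self, one_mul]
    positivity

lemma hasStage_succ (h : IsStaircase θ R ε σ X c W M) (hb : Bornology.IsBounded Ω) {n : ℕ}
    {η η' : ℝ} (hn : HasStage Ω u₀ v₀ (IsGood θ R) (ε * X n) (-(ε * c n)) (M n) η)
    (hη : η < η') (hη' : η' ≤ 1) :
    HasStage Ω u₀ v₀ (IsGood θ R) (ε * X (n + 1)) (-(ε * c (n + 1))) (M (n + 1)) η' := by
  obtain ⟨η₁, l1, l2⟩ := exists_between hη
  have hX := h.X_pos n
  have hX' := mul_pos h.σ_pos (h.X_pos (n + 1))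
  have hW := h.W_pos n
  have hc := h.c_pos n
  have dX := sub_pos.2 (h.X_lt n)
  have dc := sub_pos.2 (h.c_lt n)
  have s1 := hn.horizontal hb (x' := ε * X (n + 1)) (w := -(ε * W n)) l1 (by
    have : (ε * X (n + 1) - ε * X n) * (ε * X n - -(ε * W n)) =
      (ε * ε) * ((X (n + 1) - X n) * (X n + W n)) := by ring
    rw [this, h.sign_mul_self, one_mul]
    positivity) (h.good_W n (l2.le.trans hη'))
  have s2 := s1.vertical hb (y' := -(ε * c (n + 1))) (w := ε * (σ * X (n + 1))) l2 (by
    have : (-(ε * c (n + 1)) - -(ε * c n)) * (-(ε * c n) - ε * (σ * X (n + 1))) =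
      (ε * ε) * ((c (n + 1) - c n) * (c n + σ * X (n + 1))) := by ring
    rw [this, h.sign_mul_self, one_mul]
    positivity) (h.good_X (n + 1) hη')
  refine s2.mono (le_trans (le_of_eq ?_) (h.M_succ n)) le_rfl
  rw [← h.sign_div (X n + W n), ← h.sign_div (c n + σ * X (n + 1)), ← neg_div_neg_eq (ε * (c n + _))]
  congr 2
  · ring_nf
  · ring
  · ring

lemma hasStage (h : IsStaircase θ R ε σ X c W M) (hb : Bornology.IsBounded Ω) {η : ℝ}
    (h0 : HasStage Ω u₀ v₀ (IsGood θ R) (ε * X 0) 0 1 η) (hη : η < 1) (n : ℕ) :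
    HasStage Ω u₀ v₀ (IsGood θ R) (ε * X n) (-(ε * c n)) (M n) 1 := by
  -- Every split strictly increases the transverse bound, so the induction runs over all bounds η'
  -- in (η, 1] and always leaves room for the next step.
  suffices H : ∀ n, ∀ η' > η, η' ≤ 1 →
      HasStage Ω u₀ v₀ (IsGood θ R) (ε * X n) (-(ε * c n)) (M n) η' from H n 1 hη le_rfl
  intro n
  induction n with
  | zero => exact fun η' h1 h2 => h.hasStage_zero hb h0 h1 h2
  | succ n ih =>
    intro η' h1 h2
    obtain ⟨η₁, l1, l2⟩ := exists_between h1
    exact h.hasStage_succ hb (ih η₁ l1 (l2.le.trans h2)) l2 h2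

end IsStaircase

/-- The decay exponent of the staircase of slope `t`. -/
def decayExponent (θ t : ℝ) : ℝ := 1 / (1 + t / (1 + √θ)) + t / (t + (1 - √θ))

/-- With t = L(1 − √θ) the second summand of the exponent is exactly 1 − 1/(1 + L), and the first
dominates 1/(1 + L(1 − θ)) because (1 − √θ)/(1 + √θ) ≤ (1 − √θ)(1 + √θ) = 1 − θ. -/
lemma exists_lt_decayExponent {θ q : ℝ} (hθ0 : 0 < θ) (hθ1 : θ < 1) (hq : q < qBar θ) :
    ∃ t, 0 < t ∧ q < decayExponent θ t := by
  have hs0 : 0 < √θ := Real.sqrt_pos.2 hθ0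
  have hs1 : √θ < 1 := by rw [Real.sqrt_lt' one_pos]; simpa using hθ1
  have hsq : √θ * √θ = θ := Real.mul_self_sqrt hθ0.le
  obtain ⟨x, ⟨L, hL, -, rfl⟩, hx⟩ := exists_lt_of_lt_csSup
    (⟨_, 2, by norm_num, even_two, rfl⟩ : {x : ℝ | ∃ L : ℕ, 0 < L ∧ Even L ∧
      x = 1 - 1 / (1 + (L : ℝ)) + 1 / (1 + (L : ℝ) * (1 - θ))}.Nonempty) hq
  have hL' : (0 : ℝ) < L := by exact_mod_cast hL
  have hσ : 0 < 1 - √θ := by linarith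
  refine ⟨L * (1 - √θ), by positivity, hx.trans_le ?_⟩
  have h1 : L * (1 - √θ) / (L * (1 - √θ) + (1 - √θ)) = 1 - 1 / (1 + (L : ℝ)) := by
    have : (1 + (L : ℝ)) ≠ 0 := by positivity
    field_simp
    ring
  have h2 : L * (1 - √θ) / (1 + √θ) ≤ L * (1 - θ) := by
    have e : 1 - θ = (1 - √θ) * (1 + √θ) := by linarith
    rw [div_le_iff₀ (by positivity), e]
    have : 0 ≤ L * (1 - √θ) * (√θ * (2 + √θ)) := by positivity
    nlinarith
  unfold decayExponent
  rw [h1, add_comm]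
  gcongr

/-- By 1 + x ≤ exp x, the horizontal and vertical factors are at most exp(−2P₁/(X + 2)) and
exp(−2P₂/(X + 2)), whereas the right side is at least exp(−2q/X). The condition `hqX` absorbs the
difference between X and X + 2. -/
lemma mass_step_le {s t q X W : ℝ} (hs0 : 0 < s) (hs1 : s < 1) (ht : 0 < t) (hX : 0 < X)
    (hq : 0 < q)
    (hqX : q * (X + 2) ≤ (1 / (1 + t / (1 + s)) + t / (t + (1 - s))) * X) (hW0 : 0 < W)
    (hW : W ≤ t * X / (1 + s)) :
    (X + W) / (X + 2 + W) * ((t * X + (1 - s) * (X + 2)) / (t * (X + 2) + (1 - s) * (X + 2))) ≤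
      (X / (X + 2)) ^ q := by
  have hσ : 0 < 1 - s := by linarith
  set P₁ := 1 / (1 + t / (1 + s)) with hP₁
  set P₂ := t / (t + (1 - s)) with hP₂
  have hX2 : 0 < X + 2 := by linarith
  have f1 : (X + W) / (X + 2 + W) ≤ Real.exp (-(2 / (X + 2)) * P₁) := by
    have e : (X + W) / (X + 2 + W) = -(2 / (X + 2 + W)) + 1 := by field_simp; ring
    have : 2 / (X + 2) * P₁ ≤ 2 / (X + 2 + W) := by
      rw [hP₁, div_mul_div_comm, mul_one]
      gcongr
      have : t * X / (1 + s) ≤ (X + 2) * (t / (1 + s)) := by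
        rw [mul_div_assoc', mul_comm]; gcongr; linarith
      linarith
    rw [e]
    exact (Real.add_one_le_exp _).trans (Real.exp_le_exp.2 (by linarith))
  have f2 : (t * X + (1 - s) * (X + 2)) / (t * (X + 2) + (1 - s) * (X + 2)) ≤
      Real.exp (-(2 / (X + 2)) * P₂) := by
    have e : (t * X + (1 - s) * (X + 2)) / (t * (X + 2) + (1 - s) * (X + 2)) =
        -(2 / (X + 2)) * P₂ + 1 := by
      have : t + (1 - s) ≠ 0 := by positivity
      rw [hP₂, ← add_mul]; field_simp; ring
    rw [e]
    exact Real.add_one_le_exp _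
  have f3 : Real.exp (-(2 / X) * q) ≤ (X / (X + 2)) ^ q := by
    rw [Real.exp_mul]
    have h1 : (X + 2) / X ≤ Real.exp (2 / X) := by
      refine le_trans (le_of_eq ?_) (Real.add_one_le_exp (2 / X))
      field_simp
      ring
    have h2 : Real.exp (-(2 / X)) ≤ X / (X + 2) := by
      rw [Real.exp_neg, ← inv_div (X + 2) X]
      exact inv_anti₀ (by positivity) h1
    gcongr
  calc _ ≤ Real.exp (-(2 / (X + 2)) * P₁) * Real.exp (-(2 / (X + 2)) * P₂) := by
        gcongr
    _ = Real.exp (-(2 / (X + 2)) * (P₁ + P₂)) := by rw [← Real.exp_add]; ring_nf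
    _ ≤ Real.exp (-(2 / X) * q) := by
        apply Real.exp_le_exp.2
        rw [neg_mul, neg_mul, neg_le_neg_iff, div_mul_eq_mul_div, div_mul_eq_mul_div,
          div_le_div_iff₀ hX hX2]
        nlinarith
    _ ≤ _ := f3

lemma sin_pi_mul_eq_neg_one {ε : ℝ} (hε : ε = 1 ∨ ε = -1) (m : ℤ) :
    Real.sin (Real.pi * (ε * (1 + ε / 2 + 2 * m))) = -1 := by
  rcases hε with rfl | rfl
  · have : Real.pi * (1 * (1 + 1 / 2 + 2 * (m : ℝ))) =
        Real.pi / 2 + Real.pi + m * (2 * Real.pi) := by ring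
    rw [this, Real.sin_add_int_mul_two_pi, Real.sin_add_pi, Real.sin_pi_div_two]
  · have : Real.pi * (-1 * (1 + -1 / 2 + 2 * (m : ℝ))) =
        -(Real.pi / 2 + m * (2 * Real.pi)) := by ring
    rw [this, Real.sin_neg, Real.sin_add_int_mul_two_pi, Real.sin_pi_div_two]

lemma exists_staircase {θ t q R ε : ℝ} (hθ0 : 0 < θ) (hθ1 : θ < 1) (ht : 0 < t) (hq0 : 0 < q)
    (hq : q < decayExponent θ t) (hε : ε = 1 ∨ ε = -1) :
    ∃ σ X c W M, IsStaircase θ R ε σ X c W M ∧ σ ≤ 1 ∧ (∀ n, c n = t * X n) ∧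
      Tendsto (fun n => M n * X n ^ q) atTop (𝓝 0) := by
  have hs0 : 0 < √θ := Real.sqrt_pos.2 hθ0
  have hs1 : √θ < 1 := by rw [Real.sqrt_lt' one_pos]; simpa using hθ1
  set s := √θ with hs
  -- The mass will decay at rate q'. The gap above q sends M n · X n ^ q to zero; the gap below the
  -- full exponent pays for the finite step size.
  obtain ⟨q', hqq', hq'⟩ := exists_between hq
  have hq'0 : 0 < q' := hq0.trans hqq'
  set p := decayExponent θ t with hp
  have he : 0 < 1 + ε / 2 := by rcases hε with rfl | rfl <;> norm_num
  have hε1 : |ε| = 1 := by rcases hε with rfl | rfl <;> norm_num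
  -- On the class e + 2ℤ (3/2 or 1/2 modulo 2) the sine at πεx is −1, and by oddness it is +1 at
  -- −πεx; so X and W can share this class.
  set e := 1 + ε / 2 with hedef
  -- The three bounds secure, in order, X ≥ R, W ≥ |R| + 1, and the condition q'(X + 2) ≤ pX of
  -- `mass_step_le`.
  obtain ⟨k, hk⟩ := exists_nat_ge (max R (max (2 * (|R| + 3) / t) (2 * q' / (p - q'))))
  have hk1 : R ≤ k := (le_max_left _ _).trans hk
  have hk2 : 2 * (|R| + 3) / t ≤ k := (le_max_left _ _).trans ((le_max_right _ _).trans hk)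
  have hk3 : 2 * q' / (p - q') ≤ k := (le_max_right _ _).trans ((le_max_right _ _).trans hk)
  set X : ℕ → ℝ := fun n => e + 2 * (k + n) with hX
  set c : ℕ → ℝ := fun n => t * X n with hc
  -- The largest point of the class not exceeding c n/(1 + s); the error below 2 there becomes at
  -- most 2(1 + s) ≤ 4 in the residual.
  set W : ℕ → ℝ := fun n => e + 2 * (⌊(c n / (1 + s) - e) / 2⌋ : ℤ) with hW
  set M : ℕ → ℝ := fun n => (X 0 / X n) ^ q' with hM
  have hXk : ∀ n, k < X n := fun n => by
    have : (0 : ℝ) ≤ n := by positivity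
    have : (0 : ℝ) ≤ k := by positivity
    simp only [hX]; linarith
  have hX0 : ∀ n, 0 < X n := fun n => lt_of_le_of_lt (by positivity) (hXk n)
  have hXs : ∀ n, X (n + 1) = X n + 2 := fun n => by simp only [hX]; push_cast; ring
  have hW1 : ∀ n, W n ≤ c n / (1 + s) := fun n => by
    have := Int.floor_le ((c n / (1 + s) - e) / 2)
    simp only [hW]; linarith
  have hW2 : ∀ n, c n / (1 + s) - 2 < W n := fun n => by
    have := Int.lt_floor_add_one ((c n / (1 + s) - e) / 2)
    simp only [hW]; linarith
  have hW3 : ∀ n, |R| + 1 ≤ W n := fun n => by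
    have h1 : |R| + 3 ≤ c n / (1 + s) := by
      rw [div_le_iff₀ ht] at hk2
      rw [le_div_iff₀ (by positivity)]
      have h2 : t * k ≤ c n := by simp only [hc]; gcongr; exact (hXk n).le
      have h3 : (|R| + 3) * s ≤ (|R| + 3) * 1 := by gcongr
      linarith
    linarith [hW2 n]
  refine ⟨1 - s, X, c, W, M, ?_, by linarith, fun n => rfl, ?_⟩
  · refine ⟨hε, by linarith, hX0, fun n => mul_pos ht (hX0 n), fun n => ?_, fun n => ?_,
      fun n => ?_, fun n => hk1.trans (hXk n).le, fun n => ?_, fun n => ?_, fun n => ?_, ?_,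
      fun n => Real.rpow_nonneg (div_nonneg (hX0 0).le (hX0 n).le) _, fun n => ?_⟩
    · linarith [hW3 n, abs_nonneg R]
    · rw [hXs]; linarith
    · simp only [hc]; rw [hXs]; gcongr; linarith
    · linarith [hW3 n, le_abs_self R]
    · have := sin_pi_mul_eq_neg_one hε (k + n : ℤ)
      push_cast at this
      rw [amp, ← hs, this]; ring
    · have h1 : Real.sin (Real.pi * (-(ε * W n))) = 1 := by
        rw [mul_neg, Real.sin_neg]
        simp only [hW]
        rw [sin_pi_mul_eq_neg_one hε]; norm_num
      rw [amp, ← hs, h1]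
      have h2 : (1 + s * 1) * -(ε * W n) + ε * c n = ε * (c n - (1 + s) * W n) := by ring
      have h3 := hW1 n
      have h4 := hW2 n
      rw [le_div_iff₀ (by positivity)] at h3
      rw [sub_lt_iff_lt_add, div_lt_iff₀ (by positivity)] at h4
      rw [h2, abs_mul, hε1, one_mul, abs_le]
      constructor <;> nlinarith
    · simp only [hM]; rw [div_self (hX0 0).ne', Real.one_rpow]
    · have h1 := mass_step_le hs0 hs1 ht (hX0 n) hq'0 (W := W n) ?_
        (by linarith [hW3 n, abs_nonneg R]) (hW1 n)
      · simp only [hM, hc]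
        have e1 : X 0 / X (n + 1) = X 0 / X n * (X n / (X n + 2)) := by
          have := hX0 n
          rw [hXs]; field_simp
        have := hX0 n
        have := hX0 0
        rw [e1, Real.mul_rpow (by positivity) (by positivity), mul_assoc, hXs]
        gcongr
      · rw [div_le_iff₀ (by linarith)] at hk3
        have h2 : k * (p - q') ≤ X n * (p - q') := by
          gcongr
          exact (hXk n).le
        have : q' * (X n + 2) ≤ p * X n := by linarith
        exact this
  · have h1 : Tendsto X atTop atTop := by
      refine tendsto_atTop_mono (f := fun n : ℕ => (n : ℝ)) (fun n => ?_) tendsto_natCast_atTop_atTop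
      have : (0 : ℝ) ≤ n := by positivity
      have : (0 : ℝ) ≤ k := by positivity
      simp only [hX]; linarith
    have h2 : Tendsto (fun n => X 0 ^ q' * X n ^ (-(q' - q))) atTop (𝓝 (X 0 ^ q' * 0)) :=
      ((tendsto_rpow_neg_atTop (sub_pos.2 hqq')).comp h1).const_mul _
    rw [mul_zero] at h2
    refine h2.congr fun n => ?_
    simp only [hM]
    rw [Real.div_rpow (hX0 0).le (hX0 n).le, neg_sub, Real.rpow_sub (hX0 n)]
    ring

/-! ### Lipschitz functions vanishing near the boundary: Sobolev membership and piecewise affinity.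
-/

lemma measurable_gradient (u : Plane → ℝ) : Measurable (gradient u) :=
  (InnerProductSpace.toDual ℝ Plane).symm.continuous.measurable.comp (measurable_fderiv ℝ u)

lemma norm_gradient_le {u : Plane → ℝ} {K : NNReal} (hL : LipschitzWith K u) (z : Plane) :
    ‖gradient u z‖ ≤ K := by
  rw [gradient, LinearIsometryEquiv.norm_map]
  exact norm_fderiv_le_of_lipschitz ℝ hL

instance : IsFiniteMeasure (volume.restrict disc : Measure Plane) :=
  ⟨by rw [Measure.restrict_apply_univ]; exact measure_ball_lt_top⟩

lemma memLp_gradient {u : Plane → ℝ} {K : NNReal} (hL : LipschitzWith K u) (p : ℝ≥0∞) :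
    MemLp (gradient u) p (volume.restrict disc) :=
  MemLp.of_bound (measurable_gradient u).aestronglyMeasurable K
    (ae_of_all _ fun z => norm_gradient_le hL z)

lemma norm_le_of_lipschitz {u : Plane → ℝ} {K : NNReal} (hL : LipschitzWith K u)
    (h0 : ∀ z ∉ disc, u z = 0) (z : Plane) : ‖u z‖ ≤ 3 * K := by
  by_cases hz : z ∈ disc
  · have hz' : ‖z‖ < 1 := by simpa [disc] using hz
    -- A unit vector lies outside the open disc, so u vanishes there; every point of the disc is
    -- within distance 2 of it.
    set y : Plane := vec 0 1 1 0 with hy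
    have hyn : ‖y‖ = 1 := by
      rw [← sq_eq_sq₀ (norm_nonneg _) zero_le_one, norm_sq_eq_of_ne (i := 0) (j := 1) (by decide),
        hy, vec_fst (by decide), vec_snd (by decide)]
      norm_num
    have hyd : y ∉ disc := by simp [disc, hyn]
    have h1 := hL.dist_le_mul z y
    rw [h0 y hyd, dist_zero_right] at h1
    have h2 : dist z y ≤ 2 := by
      rw [dist_eq_norm]
      linarith [norm_sub_le z y]
    calc _ ≤ K * dist z y := h1
      _ ≤ K * 2 := by gcongr
      _ ≤ _ := by linarith [K.2, show (0 : ℝ) ≤ K from K.2]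
  · rw [h0 z hz]; simp

lemma memLp_of_lipschitz {u : Plane → ℝ} {K : NNReal} (hL : LipschitzWith K u)
    (h0 : ∀ z ∉ disc, u z = 0) (p : ℝ≥0∞) : MemLp u p (volume.restrict disc) :=
  MemLp.of_bound hL.continuous.aestronglyMeasurable (3 * K)
    (ae_of_all _ fun z => norm_le_of_lipschitz hL h0 z)

lemma hasCompactSupport_of_eq_zero {u : Plane → ℝ} (h0 : ∀ z ∉ disc, u z = 0) :
    HasCompactSupport u :=
  HasCompactSupport.of_support_subset_isCompact (isCompact_closedBall (0 : Plane) 1) fun z hz =>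
    Metric.ball_subset_closedBall (by_contra fun hzΩ => hz (h0 z hzΩ))

lemma lineDeriv_eq_inner_gradient {u : Plane → ℝ} {z : Plane} (h : DifferentiableAt ℝ u z)
    (w : Plane) : lineDeriv ℝ u z w = inner ℝ (gradient u z) w := by
  rw [h.lineDeriv_eq_fderiv, inner_gradient_left]

/-- Since u and φ vanish off the disc, both integrals extend to the plane; pairing with a fixed w
reduces the identity to integration by parts for directional derivatives, with Rademacher's theorem
identifying that of u. -/
lemma hasWeakGradient_of_lipschitz {u : Plane → ℝ} {K : NNReal} (hL : LipschitzWith K u)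
    (h0 : ∀ z ∉ disc, u z = 0) : HasWeakGradient disc u (gradient u) := by
  have hgl : LocallyIntegrable (gradient u) :=
    (memLp_top_of_bound (measurable_gradient u).aestronglyMeasurable K
      (ae_of_all _ fun z => norm_gradient_le hL z)).locallyIntegrable le_top
  refine ⟨hL.continuous.locallyIntegrable.locallyIntegrableOn _, hgl.locallyIntegrableOn _, ?_⟩
  rintro φ ⟨hφ, hφc, hφd⟩
  have hφ0 : ∀ z ∉ disc, φ z = 0 := fun z hz => by
    by_contra h
    exact hz (hφd (subset_tsupport _ h))
  obtain ⟨D, hD⟩ := hφ.lipschitzWith_of_hasCompactSupport hφc (by simp)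
  rw [setIntegral_eq_integral_of_forall_compl_eq_zero (fun z hz => by rw [h0 z hz, zero_smul]),
    setIntegral_eq_integral_of_forall_compl_eq_zero (fun z hz => by rw [hφ0 z hz, zero_smul])]
  have i1 : Integrable fun z => u z • gradient φ z := by
    exact (hL.continuous.integrable_of_hasCompactSupport
      (hasCompactSupport_of_eq_zero h0)).smul_bdd D (measurable_gradient φ).aestronglyMeasurable
      (ae_of_all _ fun z => norm_gradient_le hD z)
  have i2 : Integrable fun z => φ z • gradient u z := by
    exact (hφ.continuous.integrable_of_hasCompactSupport hφc).smul_bdd K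
      (measurable_gradient u).aestronglyMeasurable (ae_of_all _ fun z => norm_gradient_le hL z)
  refine ext_inner_left ℝ fun w => ?_
  rw [inner_neg_right, ← integral_inner i1, ← integral_inner i2]
  have key := LipschitzWith.integral_lineDeriv_mul_eq (μ := (volume : Measure Plane)) hD hL
    (hasCompactSupport_of_eq_zero h0) w
  have e1 : ∀ z, inner ℝ w (u z • gradient φ z) = lineDeriv ℝ φ z w * u z := fun z => by
    rw [lineDeriv_eq_inner_gradient (hφ.differentiable (by simp)).differentiableAt,
      real_inner_smul_right, real_inner_comm]
    ring
  simp_rw [e1]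
  rw [key, ← integral_neg]
  refine integral_congr_ae ?_
  filter_upwards [hL.ae_differentiableAt] with z hz
  rw [lineDeriv_eq_inner_gradient hz, inner_neg_right, real_inner_smul_right, real_inner_comm]
  ring

/-- Mollification of a Lipschitz function supported in the disc of radius `1/2`. -/
lemma exists_mollification {u : Plane → ℝ} {K : NNReal} (hL : LipschitzWith K u)
    (h0 : ∀ z ∉ Metric.ball (0 : Plane) (1 / 2), u z = 0) {ε : ℝ} (hε : 0 < ε) (hε' : ε ≤ 1 / 4) :
    ∃ g : Plane → ℝ, IsTestFunction disc g ∧ LipschitzWith K g ∧ (∀ x, |g x - u x| ≤ K * ε) ∧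
      ∀ z ξ c, (∀ y ∈ Metric.ball z (2 * ε), u y = inner ℝ ξ y + c) → IsAffineNear g z ξ := by
  let φ : ContDiffBump (0 : Plane) := ⟨ε / 2, ε, half_pos hε, half_lt_self hε⟩
  set ψ : Plane → ℝ := φ.normed volume with hψ
  have hψc : Continuous ψ := φ.continuous_normed
  have hψi : Integrable ψ := φ.integrable_normed
  have hψcs : HasCompactSupport ψ := φ.hasCompactSupport_normed
  have hψ0 : ∀ t, ψ t ≠ 0 → ‖t‖ < ε := fun t ht => by
    have : t ∈ Function.support ψ := ht
    rw [hψ, φ.support_normed_eq] at this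
    simpa using this
  have hint : ∀ f : Plane → ℝ, Continuous f → Integrable fun t => ψ t * f t := fun f hf =>
    (hψc.mul hf).integrable_of_hasCompactSupport hψcs.mul_right
  set g : Plane → ℝ := convolution ψ u (ContinuousLinearMap.lsmul ℝ ℝ) volume with hg
  have hgx : ∀ x, g x = ∫ t, ψ t * u (x - t) := fun x => by
    rw [hg, convolution_def]; rfl
  have hsupp : tsupport g ⊆ Metric.closedBall 0 (3 / 4) := by
    refine closure_minimal ?_ Metric.isClosed_closedBall
    intro x hx
    obtain ⟨a, ha, b, hb, rfl⟩ := support_convolution_subset _ hx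
    have h1 := hψ0 a ha
    have h2 : b ∈ Metric.ball (0 : Plane) (1 / 2) := by_contra fun h => hb (h0 b h)
    rw [mem_ball_zero_iff] at h2
    rw [mem_closedBall_zero_iff]
    linarith [norm_add_le a b]
  have hc : ∀ x, Continuous fun t => u (x - t) := fun x =>
    hL.continuous.comp (continuous_const.sub continuous_id)
  refine ⟨g, ⟨?_, ?_, ?_⟩, ?_, ?_, ?_⟩
  · exact φ.hasCompactSupport_normed.contDiff_convolution_left _ φ.contDiff_normed
      hL.continuous.locallyIntegrable
  · exact (isCompact_closedBall (0 : Plane) (3 / 4)).of_isClosed_subset (isClosed_tsupport _) hsupp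
  · exact hsupp.trans (Metric.closedBall_subset_ball (by norm_num))
  · refine LipschitzWith.of_le_add_mul K fun x y => ?_
    have e : K * dist x y = ∫ t, ψ t * (K * dist x y) := by
      rw [integral_mul_const, φ.integral_normed, one_mul]
    rw [e, hgx, hgx, ← integral_add (hint _ (hc y)) (hint _ continuous_const)]
    refine integral_mono (hint _ (hc x)) ((hint _ (hc y)).add (hint _ continuous_const)) fun t => ?_
    simp only
    rw [← mul_add]
    refine mul_le_mul_of_nonneg_left ?_ (φ.nonneg_normed t)
    have := hL.le_add_mul (x - t) (y - t)
    rwa [dist_sub_right] at this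
  · intro x
    rw [← Real.dist_eq]
    refine φ.dist_normed_convolution_le hL.continuous.aestronglyMeasurable fun y hy => ?_
    refine (hL.dist_le_mul y x).trans ?_
    gcongr
    exact (Metric.mem_ball.1 hy).le
  · intro z ξ c h
    -- Averaging an affine function against a kernel of unit mass changes only its constant term.
    refine ⟨∫ t, ψ t * (c - inner ℝ ξ t), ?_⟩
    filter_upwards [Metric.ball_mem_nhds z hε] with y hy
    have e : inner ℝ ξ y = ∫ t, ψ t * inner ℝ ξ y := by
      rw [integral_mul_const, φ.integral_normed, one_mul]
    rw [e, hgx, ← integral_add (hint _ continuous_const) (hint _ (by fun_prop))]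
    refine integral_congr_ae (ae_of_all _ fun t => ?_)
    simp only
    by_cases ht : ψ t = 0
    · rw [ht]; ring
    · have h1 := hψ0 t ht
      have : y - t ∈ Metric.ball z (2 * ε) := by
        rw [Metric.mem_ball, dist_eq_norm] at *
        have := norm_sub_le (y - z) t
        rw [show y - t - z = y - z - t by abel]
        linarith
      rw [h _ this, inner_sub_right]
      ring

lemma tendsto_eLpNorm_two_zero {α E : Type*} [MeasurableSpace α] [NormedAddCommGroup E]
    {μ : Measure α} [IsFiniteMeasure μ] {f : ℕ → α → E} {C : ℝ}
    (hf : ∀ n, AEStronglyMeasurable (f n) μ) (hC : ∀ n x, ‖f n x‖ ≤ C)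
    (h : ∀ᵐ x ∂μ, Tendsto (fun n => f n x) atTop (𝓝 0)) :
    Tendsto (fun n => eLpNorm (f n) 2 μ) atTop (𝓝 0) := by
  have key : Tendsto (fun n => ∫⁻ x, ‖f n x‖ₑ ^ (2 : ℝ) ∂μ) atTop (𝓝 (∫⁻ _, 0 ∂μ)) := by
    refine tendsto_lintegral_of_dominated_convergence' (fun _ => ENNReal.ofReal C ^ (2 : ℝ))
      (fun n => (hf n).enorm.pow_const _) (fun n => ae_of_all _ fun x => ?_) ?_ ?_
    · refine ENNReal.rpow_le_rpow ?_ (by norm_num)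
      rw [← ofReal_norm]
      exact ENNReal.ofReal_le_ofReal (hC n x)
    · rw [lintegral_const]
      exact ENNReal.mul_ne_top (by simp) (measure_ne_top _ _)
    · filter_upwards [h] with x hx
      have h1 : Tendsto (fun n => ‖f n x‖ₑ) atTop (𝓝 0) := by
        simpa using hx.enorm
      have h2 := h1.ennrpow_const 2
      simpa using h2
  rw [lintegral_zero] at key
  have := key.ennrpow_const (1 / 2)
  simp only [one_div, ENNReal.zero_rpow_of_pos (show (0 : ℝ) < 2⁻¹ by norm_num)] at this
  refine this.congr fun n => ?_
  rw [eLpNorm_eq_lintegral_rpow_enorm_toReal (by simp) (by simp)]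
  simp

section

variable {u : Plane → ℝ} {K : NNReal}

lemma eq_zero_of_notMem_disc (h0 : ∀ z ∉ Metric.ball (0 : Plane) (1 / 2), u z = 0) :
    ∀ z ∉ disc, u z = 0 :=
  fun z hz => h0 z fun h => hz (Metric.ball_subset_ball (by norm_num) h)

/-- Mollifications are test functions with the same Lipschitz constant. At a point where u is
locally affine their gradients eventually equal that of u, so dominated convergence gives
convergence in L². -/
lemma memW1Zero_two (hL : LipschitzWith K u)
    (h0 : ∀ z ∉ Metric.ball (0 : Plane) (1 / 2), u z = 0)
    (ha : ∀ᵐ z, ∃ ξ, IsAffineNear u z ξ) : MemW1Zero disc 2 u := by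
  have h0' := eq_zero_of_notMem_disc h0
  refine ⟨memLp_of_lipschitz hL h0' 2, gradient u, memLp_gradient hL 2,
    hasWeakGradient_of_lipschitz hL h0', ?_⟩
  have hε : ∀ n : ℕ, (0 : ℝ) < 1 / (n + 4) ∧ 1 / ((n : ℝ) + 4) ≤ 1 / 4 := fun n =>
    ⟨by positivity, one_div_le_one_div_of_le (by norm_num) (by
      have : (0 : ℝ) ≤ n := by positivity
      linarith)⟩
  have hlim : Tendsto (fun n : ℕ => 1 / ((n : ℝ) + 4)) atTop (𝓝 0) := by
    simp only [one_div]
    exact (tendsto_atTop_add_const_right _ _ tendsto_natCast_atTop_atTop).inv_tendsto_atTop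
  choose g hg hgL hgu hga using fun n => exists_mollification hL h0 (hε n).1 (hε n).2
  refine ⟨g, hg, ?_, ?_⟩
  · refine tendsto_eLpNorm_two_zero (C := K) (fun n =>
      ((hgL n).continuous.sub hL.continuous).aestronglyMeasurable) (fun n x => ?_)
      (ae_of_all _ fun x => ?_)
    · refine (hgu n x).trans ?_
      have := (hε n).2
      have : (K : ℝ) * (1 / (n + 4)) ≤ K * 1 := by gcongr; linarith
      linarith
    · refine squeeze_zero_norm (fun n => hgu n x) ?_
      simpa using hlim.const_mul (K : ℝ)
  · refine tendsto_eLpNorm_two_zero (C := K + K) (fun n =>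
      ((measurable_gradient _).sub (measurable_gradient _)).aestronglyMeasurable) (fun n x => ?_)
      (ae_restrict_of_ae ?_)
    · exact (norm_sub_le _ _).trans (add_le_add (norm_gradient_le (hgL n) x)
        (norm_gradient_le hL x))
    · filter_upwards [ha] with z hz
      obtain ⟨ξ, c, hc⟩ := id hz
      have hu : gradient u z = ξ := IsAffineNear.gradient_eq ⟨c, hc⟩
      obtain ⟨r, hr, hr'⟩ := Metric.eventually_nhds_iff_ball.1 hc
      refine tendsto_const_nhds.congr' ?_
      have h2 : ∀ᶠ n : ℕ in atTop, 1 / ((n : ℝ) + 4) < r / 2 :=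
        hlim.eventually (gt_mem_nhds (half_pos hr))
      filter_upwards [h2] with n hn
      have := (hga n z ξ c fun y hy => hr' y (Metric.ball_subset_ball (by linarith) hy)).gradient_eq
      rw [this, hu, sub_self]

/-- Vitali's theorem packs almost all of the disc with disjoint closed balls on which u is affine;
their interiors are the regular domains, since spheres are null. -/
lemma isPiecewiseAffine_of_ae_affine (hL : LipschitzWith K u)
    (h0 : ∀ z ∉ disc, u z = 0)
    (ha : ∀ᵐ z, ∃ ξ, IsAffineNear u z ξ) : IsPiecewiseAffine disc u := by
  refine ⟨⟨memLp_of_lipschitz hL h0 1, gradient u, memLp_gradient hL 1,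
    hasWeakGradient_of_lipschitz hL h0⟩, ?_⟩
  set G : Set Plane := disc ∩ {z | ∃ ξ, IsAffineNear u z ξ} with hG
  let t : Set (Plane × ℝ) := {a | 0 < a.2 ∧ Metric.closedBall a.1 a.2 ⊆ disc ∧
    ∃ (ξ : Plane) (b : ℝ), ∀ x ∈ Metric.closedBall a.1 a.2, u x = inner ℝ ξ x + b}
  obtain ⟨s, hst, hsc, hsd, hs0⟩ := Vitali.exists_disjoint_covering_ae (volume : Measure Plane) G t
    (Real.toNNReal 9) (fun a => a.2) (fun a => a.1) (fun a => Metric.closedBall a.1 a.2)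
    (fun a _ => subset_rfl)
    (fun a ha => by
      have h1 := ha.1
      rw [Measure.addHaar_closedBall _ _ (by positivity),
        Measure.addHaar_closedBall _ _ h1.le]
      refine le_of_eq ?_
      change _ = ENNReal.ofReal 9 * _
      rw [← mul_assoc, ← ENNReal.ofReal_mul (by norm_num)]
      congr 2
      simp only [finrank_euclideanSpace, Fintype.card_fin]
      ring)
    (fun a ha => ⟨a.1, mem_interior_iff_mem_nhds.2 (Metric.closedBall_mem_nhds _ ha.1)⟩)
    (fun a _ => Metric.isClosed_closedBall)
    (by
      rintro x ⟨hx, ξ, c, hc⟩ ε hε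
      obtain ⟨r, hr, hr'⟩ := Metric.nhds_basis_closedBall.mem_iff.1
        (inter_mem (Metric.isOpen_ball.mem_nhds hx) hc)
      refine ⟨(x, min ε r), ⟨lt_min hε hr, ?_, ξ, c, ?_⟩, min_le_left _ _, rfl⟩
      · exact fun y hy => (hr' (Metric.closedBall_subset_closedBall (min_le_right _ _) hy)).1
      · exact fun y hy => (hr' (Metric.closedBall_subset_closedBall (min_le_right _ _) hy)).2)
  refine ⟨(fun a : Plane × ℝ => Metric.ball a.1 a.2) '' s, hsc.image _, ?_, ?_, ?_⟩
  · rintro _ ⟨a, ha, rfl⟩ _ ⟨b, hb, rfl⟩ hab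
    have hne : a ≠ b := fun h => hab (by rw [h])
    exact (hsd ha hb hne).mono Metric.ball_subset_closedBall Metric.ball_subset_closedBall
  · rintro _ ⟨a, ha, rfl⟩
    obtain ⟨h1, h2, ξ, b, h3⟩ := hst ha
    refine ⟨⟨Metric.isOpen_ball, Metric.isBounded_ball,
      ⟨Metric.nonempty_ball.2 h1, (convex_ball _ _).isPreconnected⟩, ?_⟩,
      Metric.ball_subset_closedBall.trans h2, ξ, b,
      fun x hx => h3 x (Metric.ball_subset_closedBall hx)⟩
    rw [frontier_ball _ h1.ne']
    exact Measure.addHaar_sphere _ _ _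
  · refine measure_mono_null (t := {z | ¬ ∃ ξ, IsAffineNear u z ξ} ∪
      (G \ ⋃ a ∈ s, Metric.closedBall a.1 a.2) ∪ ⋃ a ∈ s, Metric.sphere a.1 a.2) ?_ ?_
    · rintro z ⟨hz, hz'⟩
      by_contra hcon
      simp only [Set.mem_union, not_or, Set.mem_sdiff, Set.mem_iUnion, not_exists] at hcon
      obtain ⟨⟨c1, c2⟩, c3⟩ := hcon
      have hzG : z ∈ G := ⟨hz, by_contra fun h => c1 fun ξ hξ => h ⟨ξ, hξ⟩⟩
      push Not at c2
      obtain ⟨a, ha, hza⟩ := c2 hzG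
      refine hz' ⟨_, ⟨a, ha, rfl⟩, ?_⟩
      exact lt_of_le_of_ne hza (c3 a ha)
    · rw [measure_union_null_iff, measure_union_null_iff]
      exact ⟨⟨ae_iff.1 ha, hs0⟩,
        (measure_biUnion_null_iff hsc).2 fun a _ => Measure.addHaar_sphere _ _ _⟩

end

/-! ### Combining the two staircases and estimating the residual. -/

lemma abs_amp_le {θ : ℝ} (hθ1 : θ < 1) (t : ℝ) : |amp θ t| ≤ 2 * |t| := by
  have hs1 : √θ < 1 := by rw [Real.sqrt_lt' one_pos]; simpa using hθ1
  have hs0 := Real.sqrt_nonneg θ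
  rw [amp, abs_mul]
  gcongr
  refine (abs_add_le _ _).trans ?_
  rw [abs_one, abs_mul, abs_of_nonneg hs0]
  have := mul_le_mul hs1.le (Real.abs_sin_le_one (Real.pi * t)) (abs_nonneg _) zero_le_one
  linarith

/-- Two staircases, one for each sign, give a pair of functions on the disc of radius `1/2`. -/
lemma exists_pair {θ R σ σ' : ℝ} {X c W M X' c' W' M' : ℕ → ℝ}
    (h₁ : IsStaircase θ R 1 σ X c W M) (h₂ : IsStaircase θ R (-1) σ' X' c' W' M') (n : ℕ) :
    ∃ u v : Plane → ℝ, (∃ K, LipschitzWith K u) ∧ (∃ K, LipschitzWith K v) ∧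
      (∀ z ∉ Metric.ball (0 : Plane) (1 / 2), u z = 0) ∧
      (∀ z ∉ Metric.ball (0 : Plane) (1 / 2), v z = 0) ∧
      ∃ T₁ T₂ : Set Plane, MeasurableSet T₁ ∧ MeasurableSet T₂ ∧ T₁ ⊆ disc ∧ T₂ ⊆ disc ∧
        volume.real T₁ ≤ M n * volume.real disc ∧ volume.real T₂ ≤ M' n * volume.real disc ∧
        ∀ᵐ z, z ∈ Metric.ball (0 : Plane) (1 / 2) →
          ∃ ξ ζ, IsAffineNear u z ξ ∧ IsAffineNear v z ζ ∧ R ≤ |ξ 0| ∧ |ξ 1| ≤ 1 ∧ |ζ 0| ≤ 1 ∧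
            (|amp θ (ξ 0) + ζ 1| ≤ 4 ∨ (z ∈ T₁ ∧ |amp θ (ξ 0) + ζ 1| = σ * X n + c n) ∨
              (z ∈ T₂ ∧ |amp θ (ξ 0) + ζ 1| = σ' * X' n + c' n)) := by
  set B := Metric.ball (0 : Plane) (1 / 2) with hB
  have hBb : Bornology.IsBounded B := Metric.isBounded_ball
  have hBd : B ⊆ disc := Metric.ball_subset_ball (by norm_num)
  obtain ⟨h, hL, h0, G₁, G₂, o1, o2, s1, s2, hd, hnull, -, a1, a2⟩ :=
    exists_laminate (i := 0) (j := 1) (by decide) (Metric.isOpen_ball : IsOpen B) hBb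
      (h₁.X_pos 0) (h₂.X_pos 0) (δ := 1 / 2) (by norm_num)
  have z0 : ∀ z, IsAffineNear (fun _ : Plane => (0 : ℝ)) z 0 := fun z => ⟨0, by simp⟩
  obtain ⟨u₁, v₁, T₁, D₁, H₁⟩ := h₁.hasStage (hBb.subset s1) (u₀ := h) (v₀ := fun _ => 0)
    (η := 1 / 2) (HasStage.init hL ⟨0, LipschitzWith.const _⟩ o1 fun z hz => by
      obtain ⟨ξ, hξ, e1, e2⟩ := a1 z hz
      exact ⟨ξ, 0, hξ, z0 z, by rw [e1, one_mul], by simp, e2, by simp⟩) (by norm_num) n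
  -- The first staircase altered nothing on G₂, so there u₁ still has ∂₁ = −X' 0 and v₁ is still
  -- zero.
  obtain ⟨u, v, T₂, D₂, H₂⟩ := h₂.hasStage (hBb.subset s2) (u₀ := u₁) (v₀ := v₁)
    (η := 1 / 2) (HasStage.init H₁.lip_u H₁.lip_v o2 fun z hz => by
      obtain ⟨ξ, hξ, e1, e2⟩ := a2 z hz
      exact ⟨ξ, 0, hξ.congr (eventuallyEq_of_disjoint H₁.eq_u o2 hd hz),
        (z0 z).congr (eventuallyEq_of_disjoint H₁.eq_v o2 hd hz), by rw [e1]; ring, by simp, e2,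
        by simp⟩) (by norm_num) n
  have hmono : ∀ G ⊆ B, volume.real G ≤ volume.real disc := fun G hG =>
    measureReal_mono (hG.trans hBd) measure_ball_lt_top.ne
  refine ⟨u, v, H₂.lip_u, H₂.lip_v, fun z hz => ?_, fun z hz => ?_, T₁, T₂,
    H₁.isOpen_T.measurableSet, H₂.isOpen_T.measurableSet,
    H₁.T_subset.trans (s1.trans hBd), H₂.T_subset.trans (s2.trans hBd),
    H₁.measure_le.trans (mul_le_mul_of_nonneg_left (hmono G₁ s1) (h₁.M_nonneg n)),
    H₂.measure_le.trans (mul_le_mul_of_nonneg_left (hmono G₂ s2) (h₂.M_nonneg n)), ?_⟩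
  · rw [H₂.eq_u z fun hz' => hz (s2 hz'), H₁.eq_u z fun hz' => hz (s1 hz'), h0 z hz]
  · rw [H₂.eq_v z fun hz' => hz (s2 hz'), H₁.eq_v z fun hz' => hz (s1 hz')]
  filter_upwards [compl_mem_ae_iff.2 hnull, compl_mem_ae_iff.2 H₁.null,
    compl_mem_ae_iff.2 H₂.null] with z n0 n1 n2 hz
  have hd₁ : ∀ S ⊆ G₁, Disjoint G₂ S := fun S hS => (hd.mono_left hS).symm
  rcases (by_contra fun hc => n0 ⟨hz, hc⟩ : z ∈ G₁ ∪ G₂) with hzG | hzG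
  · rcases (by_contra fun hc => n1 ⟨hzG, hc⟩ : z ∈ T₁ ∪ D₁) with hzT | hzD
    · obtain ⟨ξ, ζ, k1, k2, k3, k4, k5, k6⟩ := H₁.on_T z hzT
      refine ⟨ξ, ζ, k1.congr (eventuallyEq_of_disjoint H₂.eq_u H₁.isOpen_T
        (hd₁ _ H₁.T_subset) hzT), k2.congr (eventuallyEq_of_disjoint H₂.eq_v H₁.isOpen_T
        (hd₁ _ H₁.T_subset) hzT), ?_, k5, k6, .inr (.inl ⟨hzT, ?_⟩)⟩
      · rw [k3, one_mul, abs_of_pos (h₁.X_pos n)]; exact h₁.le_X n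
      · have := h₁.X_pos n
        have := h₁.c_pos n
        have := h₁.σ_pos
        rw [k3, k4, h₁.amp_X, abs_of_pos (by ring_nf; positivity)]; ring
    · obtain ⟨ξ, ζ, k1, k2, k3⟩ := H₁.on_D z hzD
      exact ⟨ξ, ζ, k1.congr (eventuallyEq_of_disjoint H₂.eq_u H₁.isOpen_D
        (hd₁ _ H₁.D_subset) hzD), k2.congr (eventuallyEq_of_disjoint H₂.eq_v H₁.isOpen_D
        (hd₁ _ H₁.D_subset) hzD), k3.1, k3.2.2.1, k3.2.2.2, .inl k3.2.1⟩
  · rcases (by_contra fun hc => n2 ⟨hzG, hc⟩ : z ∈ T₂ ∪ D₂) with hzT | hzD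
    · obtain ⟨ξ, ζ, k1, k2, k3, k4, k5, k6⟩ := H₂.on_T z hzT
      refine ⟨ξ, ζ, k1, k2, ?_, k5, k6, .inr (.inr ⟨hzT, ?_⟩)⟩
      · rw [k3, abs_mul, h₂.abs_sign, one_mul, abs_of_pos (h₂.X_pos n)]; exact h₂.le_X n
      · have := h₂.X_pos n
        have := h₂.c_pos n
        have := h₂.σ_pos
        rw [k3, k4, h₂.amp_X, ← abs_neg, abs_of_pos (by ring_nf; positivity)]; ring
    · obtain ⟨ξ, ζ, k1, k2, k3⟩ := H₂.on_D z hzD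
      exact ⟨ξ, ζ, k1, k2, k3.1, k3.2.2.1, k3.2.2.2, .inl k3.2.1⟩

/-- The residual `A(∇u) - ∇^⊥ v` as a function of the two gradients. -/
def residual (θ : ℝ) (ξ ζ : Plane) : Plane :=
  !₂[amp θ (ξ 0) + ζ 1, amp θ (ξ 1) - ζ 0]

lemma sub_perpGradient_eq (θ : ℝ) (u v : Plane → ℝ) (x : Plane) :
    A θ (gradient u x) - perpGradient v x = residual θ (gradient u x) (gradient v x) := by
  ext i
  fin_cases i <;> simp [residual, A, amp, perpGradient]

lemma continuous_residual (θ : ℝ) :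
    Continuous fun p : Plane × Plane => residual θ p.1 p.2 := by
  refine (PiLp.continuous_toLp 2 _).comp (continuous_pi fun i => ?_)
  fin_cases i
  · change Continuous fun p : Plane × Plane => amp θ (p.1 0) + p.2 1
    unfold amp
    fun_prop
  · change Continuous fun p : Plane × Plane => amp θ (p.1 1) - p.2 0
    unfold amp
    fun_prop

lemma measurable_residual (θ : ℝ) (u v : Plane → ℝ) :
    Measurable fun x => residual θ (gradient u x) (gradient v x) := by
  have h := (continuous_residual θ).measurable
  have h' : Measurable fun x => (gradient u x, gradient v x) :=
    (measurable_gradient u).prodMk (measurable_gradient v)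
  generalize residual θ = F at h ⊢
  exact h.comp h'

lemma norm_residual_le {θ : ℝ} (hθ1 : θ < 1) {ξ ζ : Plane} {E : ℝ} (h0 : |amp θ (ξ 0) + ζ 1| ≤ E)
    (h1 : |ξ 1| ≤ 1) (h2 : |ζ 0| ≤ 1) : ‖residual θ ξ ζ‖ ≤ E + 3 := by
  refine (norm_le_add_of_ne (i := 0) (j := 1) (by decide) _).trans ?_
  have e0 : residual θ ξ ζ 0 = amp θ (ξ 0) + ζ 1 := rfl
  have e1 : residual θ ξ ζ 1 = amp θ (ξ 1) - ζ 0 := rfl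
  rw [e0, e1]
  have := abs_sub (amp θ (ξ 1)) (ζ 0)
  have := abs_amp_le hθ1 (ξ 1)
  linarith

lemma residual_zero (θ : ℝ) : residual θ 0 0 = 0 := by
  ext i
  fin_cases i <;> simp [residual, amp]

lemma ae_affine_or_mem_ball {u : Plane → ℝ} (h0 : ∀ z ∉ Metric.ball (0 : Plane) (1 / 2), u z = 0) :
    ∀ᵐ z, z ∉ Metric.ball (0 : Plane) (1 / 2) → IsAffineNear u z 0 := by
  filter_upwards [compl_mem_ae_iff.2
    (Measure.addHaar_sphere (volume : Measure Plane) 0 (1 / 2))] with z hz hzB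
  refine isAffineNear_zero_of_notMem_closure h0 fun hc => ?_
  have hc' := Metric.closure_ball_subset_closedBall hc
  exact hz (le_antisymm hc' (not_lt.1 hzB))

/-- The smallness condition on m involves q but not r, so a single staircase length works for all r
in (1, q). -/
lemma rpow_error_le {t X q r m : ℝ} (ht : 0 < t) (hX : 1 ≤ X) (hr1 : 1 < r) (hrq : r < q)
    (hq2 : q < 2) (hm : 0 ≤ m) (h : m * X ^ q ≤ 1 / (5 + t) ^ 2) :
    (X + t * X + 3) ^ r * m ≤ 1 := by
  have h1 : X + t * X + 3 ≤ (5 + t) * X := by nlinarith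
  have h2 : (X + t * X + 3) ^ r ≤ (5 + t) ^ 2 * X ^ q := by
    calc (X + t * X + 3) ^ r ≤ ((5 + t) * X) ^ r := by gcongr
      _ = (5 + t) ^ r * X ^ r := Real.mul_rpow (by positivity) (by positivity)
      _ ≤ (5 + t) ^ (2 : ℝ) * X ^ q := by
          gcongr
          · linarith
          · linarith
      _ = _ := by rw [Real.rpow_two]
  calc _ ≤ (5 + t) ^ 2 * X ^ q * m := by gcongr
    _ = (5 + t) ^ 2 * (m * X ^ q) := by ring
    _ ≤ (5 + t) ^ 2 * (1 / (5 + t) ^ 2) := by gcongr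
    _ = 1 := by field_simp

lemma seven_rpow_le {r : ℝ} (hr : r < 2) : (7 : ℝ) ^ r ≤ 49 := by
  calc (7 : ℝ) ^ r ≤ 7 ^ (2 : ℝ) := by gcongr; norm_num
    _ = 49 := by rw [Real.rpow_two]; norm_num

lemma decayExponent_lt_two {θ t : ℝ} (hθ1 : θ < 1) (ht : 0 < t) : decayExponent θ t < 2 := by
  have hs1 : √θ < 1 := by rw [Real.sqrt_lt' one_pos]; simpa using hθ1
  have hs0 := Real.sqrt_nonneg θ
  have h1 : 1 / (1 + t / (1 + √θ)) < 1 := by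
    rw [div_lt_one (by positivity)]
    have : 0 < t / (1 + √θ) := by positivity
    linarith
  have h2 : t / (t + (1 - √θ)) < 1 := by
    rw [div_lt_one (by linarith)]
    linarith
  unfold decayExponent
  linarith

/-- A pair of functions supported in the disc of radius `1/2` with steep first gradient and small
residual. -/
lemma exists_steep_pair {θ q : ℝ} (hθ0 : 0 < θ) (hθ1 : θ < 1) (hq1 : 1 < q) (hq2 : q < qBar θ)
    {R : ℝ} (hR : 1 ≤ R) :
    ∃ u v : Plane → ℝ, (∃ K, LipschitzWith K u) ∧ (∃ K, LipschitzWith K v) ∧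
      (∀ z ∉ Metric.ball (0 : Plane) (1 / 2), u z = 0) ∧
      (∀ z ∉ Metric.ball (0 : Plane) (1 / 2), v z = 0) ∧
      (∀ᵐ z, ∃ ξ, IsAffineNear u z ξ) ∧ (∀ᵐ z, ∃ ξ, IsAffineNear v z ξ) ∧
      (∀ᵐ z, z ∈ Metric.ball (0 : Plane) (1 / 2) → R ≤ ‖gradient u z‖) ∧
      ∀ r : ℝ, 1 < r → r < q → ∃ g : Plane → ℝ, IntegrableOn g disc ∧
        (∫ x in disc, g x) ≤ 51 * volume.real disc ∧
        ∀ᵐ z, ‖residual θ (gradient u z) (gradient v z)‖ ^ r ≤ g z := by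
  obtain ⟨t, ht, hqt⟩ := exists_lt_decayExponent hθ0 hθ1 hq2
  have hq2' : q < 2 := hqt.trans (decayExponent_lt_two hθ1 ht)
  obtain ⟨σ, X, c, W, M, h₁, hσ, hc, hM⟩ := exists_staircase (R := R) hθ0 hθ1 ht
    (zero_lt_one.trans hq1) hqt (ε := 1) (.inl rfl)
  obtain ⟨σ', X', c', W', M', h₂, hσ', hc', hM'⟩ := exists_staircase (R := R) hθ0 hθ1 ht
    (zero_lt_one.trans hq1) hqt (ε := -1) (.inr rfl)
  have hpos : (0 : ℝ) < 1 / (5 + t) ^ 2 := by positivity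
  obtain ⟨n, hn, hn'⟩ := ((hM.eventually (gt_mem_nhds hpos)).and
    (hM'.eventually (gt_mem_nhds hpos))).exists
  obtain ⟨u, v, hu, hv, hu0, hv0, T₁, T₂, m₁, m₂, s₁, s₂, v₁, v₂, hae⟩ := exists_pair h₁ h₂ n
  refine ⟨u, v, hu, hv, hu0, hv0, ?_, ?_, ?_, fun r hr1 hrq => ?_⟩
  · filter_upwards [hae, ae_affine_or_mem_ball hu0] with z h1 h2
    by_cases hz : z ∈ Metric.ball (0 : Plane) (1 / 2)
    · obtain ⟨ξ, ζ, k1, -⟩ := h1 hz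
      exact ⟨ξ, k1⟩
    · exact ⟨0, h2 hz⟩
  · filter_upwards [hae, ae_affine_or_mem_ball hv0] with z h1 h2
    by_cases hz : z ∈ Metric.ball (0 : Plane) (1 / 2)
    · obtain ⟨ξ, ζ, -, k1, -⟩ := h1 hz
      exact ⟨ζ, k1⟩
    · exact ⟨0, h2 hz⟩
  · filter_upwards [hae] with z h1 hz
    obtain ⟨ξ, ζ, k1, -, k2, -⟩ := h1 hz
    rw [k1.gradient_eq]
    exact k2.trans (abs_apply_le_norm 0 ξ)
  set E₁ := (X n + t * X n + 3) ^ r with hE₁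
  set E₂ := (X' n + t * X' n + 3) ^ r with hE₂
  have x1 := h₁.X_pos n
  have x2 := h₂.X_pos n
  have e1 : E₁ * M n ≤ 1 := rpow_error_le ht (hR.trans (h₁.le_X n)) hr1 hrq hq2'
    (h₁.M_nonneg n) hn.le
  have e2 : E₂ * M' n ≤ 1 := rpow_error_le ht (hR.trans (h₂.le_X n)) hr1 hrq hq2'
    (h₂.M_nonneg n) hn'.le
  have p1 : 0 ≤ E₁ := by positivity
  have p2 : 0 ≤ E₂ := by positivity
  have i0 : IntegrableOn (fun _ => (49 : ℝ)) disc (volume : Measure Plane) :=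
    integrable_const _
  have i1 : IntegrableOn (T₁.indicator fun _ => E₁) disc (volume : Measure Plane) :=
    (integrable_const E₁).indicator m₁
  have i2 : IntegrableOn (T₂.indicator fun _ => E₂) disc (volume : Measure Plane) :=
    (integrable_const E₂).indicator m₂
  have i01 : IntegrableOn (fun z => 49 + T₁.indicator (fun _ => E₁) z) disc volume := i0.add i1
  -- On the finished set the residual is at most 4 + 3 and 7^r ≤ 49; each unfinished set adds at
  -- most the area of the disc, whence 51.
  refine ⟨fun z => 49 + T₁.indicator (fun _ => E₁) z + T₂.indicator (fun _ => E₂) z,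
    i01.add i2, ?_, ?_⟩
  · rw [integral_add i01 i2, integral_add i0 i1, integral_indicator_const _ m₁,
      integral_indicator_const _ m₂, setIntegral_const]
    simp only [smul_eq_mul]
    rw [measureReal_restrict_apply m₁, measureReal_restrict_apply m₂,
      Set.inter_eq_left.2 s₁, Set.inter_eq_left.2 s₂]
    have hV : 0 ≤ volume.real disc := measureReal_nonneg
    have c1 : volume.real T₁ * E₁ ≤ volume.real disc := by
      calc _ ≤ M n * volume.real disc * E₁ := by gcongr
        _ = (E₁ * M n) * volume.real disc := by ring
        _ ≤ 1 * volume.real disc := by gcongr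
        _ = _ := one_mul _
    have c2 : volume.real T₂ * E₂ ≤ volume.real disc := by
      calc _ ≤ M' n * volume.real disc * E₂ := by gcongr
        _ = (E₂ * M' n) * volume.real disc := by ring
        _ ≤ 1 * volume.real disc := by gcongr
        _ = _ := one_mul _
    linarith
  · filter_upwards [hae, ae_affine_or_mem_ball hu0, ae_affine_or_mem_ball hv0] with z h1 h2 h3
    have n1 : 0 ≤ T₁.indicator (fun _ => E₁) z := Set.indicator_nonneg (fun _ _ => p1) z
    have n2 : 0 ≤ T₂.indicator (fun _ => E₂) z := Set.indicator_nonneg (fun _ _ => p2) z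
    by_cases hz : z ∈ Metric.ball (0 : Plane) (1 / 2)
    · obtain ⟨ξ, ζ, k1, k2, -, k3, k4, k5⟩ := h1 hz
      rw [k1.gradient_eq, k2.gradient_eq]
      rcases k5 with k5 | ⟨hT, k5⟩ | ⟨hT, k5⟩
      · have := norm_residual_le hθ1 k5 k3 k4
        have h7 : ‖residual θ ξ ζ‖ ^ r ≤ 7 ^ r :=
          Real.rpow_le_rpow (norm_nonneg _) (by linarith) (by linarith)
        linarith [seven_rpow_le (hrq.trans hq2')]
      · have := norm_residual_le hθ1 k5.le k3 k4
        have hx : σ * X n ≤ 1 * X n := by gcongr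
        rw [hc] at this
        have h7 : ‖residual θ ξ ζ‖ ^ r ≤ E₁ :=
          Real.rpow_le_rpow (norm_nonneg _) (by linarith) (by linarith)
        rw [Set.indicator_of_mem hT]
        linarith
      · have := norm_residual_le hθ1 k5.le k3 k4
        have hx : σ' * X' n ≤ 1 * X' n := by gcongr
        rw [hc'] at this
        have h7 : ‖residual θ ξ ζ‖ ^ r ≤ E₂ :=
          Real.rpow_le_rpow (norm_nonneg _) (by linarith) (by linarith)
        rw [Set.indicator_of_mem hT]
        linarith
    · rw [(h2 hz).gradient_eq, (h3 hz).gradient_eq, residual_zero, norm_zero,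
        Real.zero_rpow (by linarith)]
      linarith

end CZ

end

theorem mainTheorem3 (θ : ℝ) (hθ0 : 0 < θ) (hθ1 : θ < 1) (Λ : ℝ) (hΛ : 0 < Λ)
    (q : ℝ) (hq1 : 1 < q) (hq2 : q < CZ.qBar θ) :
    ∃ u v : CZ.Plane → ℝ,
      CZ.IsPiecewiseAffine CZ.disc u ∧ CZ.IsPiecewiseAffine CZ.disc v ∧
      CZ.MemW1Zero CZ.disc 2 u ∧ CZ.MemW1Zero CZ.disc 2 v ∧
      (∃ K, LipschitzOnWith K u CZ.disc) ∧ (∃ K, LipschitzOnWith K v CZ.disc) ∧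
      ∀ r : ℝ, 1 < r → r < q →
        IntegrableOn (fun x => ‖gradient u x‖ ^ r) CZ.disc ∧
        IntegrableOn (fun x => ‖CZ.A θ (gradient u x) - CZ.perpGradient v x‖ ^ r) CZ.disc ∧
        ∫ x in CZ.disc, ‖gradient u x‖ ^ r >
          Λ * (1 + ∫ x in CZ.disc, ‖CZ.A θ (gradient u x) - CZ.perpGradient v x‖ ^ r) := by
  set B := Metric.ball (0 : CZ.Plane) (1 / 2) with hB
  have hV : 0 < volume.real B :=
    ENNReal.toReal_pos (Metric.measure_ball_pos _ _ (by norm_num)).ne' measure_ball_lt_top.ne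
  -- C bounds the whole right-hand side whatever R is, so R may be chosen afterwards with R·|B| ≥ C
  -- + 1.
  set C := Λ * (1 + 51 * volume.real CZ.disc) with hC
  obtain ⟨u, v, ⟨K, hu⟩, ⟨K', hv⟩, hu0, hv0, hua, hva, hR, hg⟩ :=
    CZ.exists_steep_pair hθ0 hθ1 hq1 hq2 (le_max_left 1 ((C + 1) / volume.real B))
  set R := max 1 ((C + 1) / volume.real B) with hRdef
  refine ⟨u, v, CZ.isPiecewiseAffine_of_ae_affine hu (CZ.eq_zero_of_notMem_disc hu0) hua,
    CZ.isPiecewiseAffine_of_ae_affine hv (CZ.eq_zero_of_notMem_disc hv0) hva,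
    CZ.memW1Zero_two hu hu0 hua, CZ.memW1Zero_two hv hv0 hva, ⟨K, hu.lipschitzOnWith⟩,
    ⟨K', hv.lipschitzOnWith⟩, fun r hr1 hrq => ?_⟩
  obtain ⟨g, hgi, hgI, hga⟩ := hg r hr1 hrq
  simp only [CZ.sub_perpGradient_eq]
  have I1 : IntegrableOn (fun x => ‖gradient u x‖ ^ r) CZ.disc := by
    refine Integrable.of_bound ((CZ.measurable_gradient u).norm.pow_const r).aestronglyMeasurable
      ((K : ℝ) ^ r) (ae_of_all _ fun x => ?_)
    rw [Real.norm_of_nonneg (by positivity)]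
    exact Real.rpow_le_rpow (norm_nonneg _) (CZ.norm_gradient_le hu x) (by linarith)
  have I2 : IntegrableOn (fun x => ‖CZ.residual θ (gradient u x) (gradient v x)‖ ^ r) CZ.disc := by
    refine Integrable.mono' hgi
      ((CZ.measurable_residual θ u v).norm.pow_const r).aestronglyMeasurable
      (ae_restrict_of_ae ?_)
    filter_upwards [hga] with z hz
    rwa [Real.norm_of_nonneg (by positivity)]
  refine ⟨I1, I2, ?_⟩
  have J2 : ∫ x in CZ.disc, ‖CZ.residual θ (gradient u x) (gradient v x)‖ ^ r ≤
      51 * volume.real CZ.disc :=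
    (integral_mono_ae I2 hgi (ae_restrict_of_ae hga)).trans hgI
  have hBd : B ⊆ CZ.disc := Metric.ball_subset_ball (by norm_num)
  have J1 : R * volume.real B ≤ ∫ x in CZ.disc, ‖gradient u x‖ ^ r := by
    calc R * volume.real B = ∫ _ in B, R := by rw [setIntegral_const, smul_eq_mul, mul_comm]
      _ ≤ ∫ x in B, ‖gradient u x‖ ^ r := by
          refine setIntegral_mono_ae_restrict (integrableOn_const measure_ball_lt_top.ne)
            (I1.mono_set hBd) ?_
          filter_upwards [ae_restrict_of_ae hR, ae_restrict_mem Metric.isOpen_ball.measurableSet]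
            with z hz hzB
          have h1 := hz hzB
          have h2 : 1 ≤ ‖gradient u z‖ := (le_max_left _ _).trans h1
          -- Taking R ≥ 1 gives R ≤ |∇u| ≤ |∇u|^r, a lower bound independent of r.
          exact h1.trans (Real.self_le_rpow_of_one_le h2 hr1.le)
      _ ≤ _ := setIntegral_mono_set I1 (ae_of_all _ fun x => by positivity)
          (LE.le.eventuallyLE hBd)
  have hRV : C + 1 ≤ R * volume.real B := by
    rw [← div_le_iff₀ hV]; exact le_max_right _ _
  have : Λ * (1 + ∫ x in CZ.disc, ‖CZ.residual θ (gradient u x) (gradient v x)‖ ^ r) ≤ C := by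
    rw [hC]; gcongr
  linarith
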